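/- Let $d,m\ge 0$ be integers, write $M=\mathbb R^d$, let $H$ be a subgroup of $GL(d)=GL(M)$ containing all scalings $c\cdot\mathrm{id}$, $c\in\mathbb R\setminus\{0\}$, and let $G=H\ltimes\mathbb R^d$ be the group of affine maps $x\mapsto Ax+b$ with $A\in H$, $b\in\mathbb R^d$, acting on smooth vector fields by $((A,b)\cdot f)(x)=A\,f(A^{-1}(x-b))$. Let $\mathfrak X(\mathbb R^d)$ be the Fréchet space of smooth vector fields on $\mathbb R^d$ (uniform convergence of all derivatives on compact sets), and let $\mathcal L_m$ be the vector space of continuous symmetric $m$-linear maps $\varphi:\mathfrak X(\mathbb R^d)^m\to\mathfrak X(\mathbb R^d)$ that are $G$-equivariant, $\varphi(g\cdot f_1,\dots,g\cdot f_m)=g\cdot\varphi(f_1,\dots,f_m)$ for $g\in G$, and local, i.e. support non-increasing: $\operatorname{supp}\varphi(f_1,\dots,f_m)\subseteq\operatorname{supp}(f_1,\dots,f_m)$, where $(f_1,\dots,f_m)$ is viewed as a section of $\bigoplus^m T\mathbb R^d$. A composition is a finitely supported map $\kappa:\mathbb N\to\mathbb N$ (with $0\in\mathbb N$); its size is $|\kappa|=\sum_j\kappa(j)$,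 and its derived composition is $\kappa'(j)=j\,\kappa(j)$. Put $$\mathrm{Sym}_\kappa = M\otimes\bigotimes_{j\ge 0}\mathrm{sym}^{\kappa(j)}\bigl(M^*\otimes \mathrm{sym}^j M\bigr),$$ with the tensor product action of $H$, and let $\mathrm{Sym}_\kappa^H$ be its subspace of $H$-invariant elements. Then there is a linear isomorphism $$\mathcal L_m\;\cong\;\bigoplus_{\substack{|\kappa|=m\\ |\kappa'|=m-1}}\mathrm{Sym}_\kappa^H ,\qquad \varphi\mapsto(S_\kappa)_\kappa ,$$ such that for every $\varphi\in\mathcal L_m$ and every vector field $f$ one has $\varphi(f,\dots,f)(0)=\sum_\kappa\langle S_\kappa,f\rangle$, where $\langle S_\kappa,f\rangle\in M$ is the contraction of $S_\kappa$ with $\kappa(j)$ copies of the derivative $f^{(j)}(0)\in \mathrm{Lin}(\mathrm{sym}^jM,M)$ for each $j$, given on products by $x\otimes\bigotimes_j\prod_{i=1}^{\kappa(j)}(\xi_{j,i}\otimes s_{j,i})\mapsto\prod_{j}\prod_{i}\xi_{j,i}\bigl(f^{(j)}(0)\,s_{j,i}\bigr)\,x$. In particular, $\mathcal L_m$ is finite-dimensional.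 -/

import Mathlib

open scoped ContDiff TensorProduct DirectSum

noncomputable section

namespace LocalEquivariant

/-! ### Smooth vector fields on `ℝ^d` with their Fréchet topology -/

/-- The space `ℝ^d`; it is also the tangent space at the origin. -/
abbrev Space (d : ℕ) : Type := EuclideanSpace ℝ (Fin d)

/-- The smooth maps `ℝ^d → ℝ^d`. -/
def smoothMaps (d : ℕ) : Submodule ℝ (Space d → Space d) where
  carrier := {f | ContDiff ℝ ∞ f}
  add_mem' {f g} (hf : ContDiff ℝ ∞ f) (hg : ContDiff ℝ ∞ g) := hf.add hg
  zero_mem' := show ContDiff ℝ ∞ (fun _ : Space d => (0 : Space d)) from contDiff_const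
  smul_mem' c f (hf : ContDiff ℝ ∞ f) := hf.const_smul c

/-- Smooth vector fields on `ℝ^d`. This is a separate type, since the subspace topology of the
topology of pointwise convergence is not the one to be used. -/
def VectorField (d : ℕ) : Type := smoothMaps d

namespace VectorField

variable {d : ℕ}

instance : AddCommGroup (VectorField d) := inferInstanceAs (AddCommGroup (smoothMaps d))

instance : Module ℝ (VectorField d) := inferInstanceAs (Module ℝ (smoothMaps d))

instance : CoeFun (VectorField d) (fun _ => Space d → Space d) := ⟨fun f => f.1⟩

theorem contDiff (f : VectorField d) : ContDiff ℝ ∞ (f : Space d → Space d) := f.2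

/-- The `k`-th derivative, as a continuous function on `ℝ^d`. -/
def iteratedDerivative (k : ℕ) :
    VectorField d →ₗ[ℝ] C(Space d, ContinuousMultilinearMap ℝ (fun _ : Fin k => Space d) (Space d))
    where
  toFun f := ⟨iteratedFDeriv ℝ k f, f.contDiff.continuous_iteratedFDeriv (by exact_mod_cast le_top)⟩
  map_add' f g := by
    ext1 x
    exact iteratedFDeriv_add_apply (f.contDiff.contDiffAt.of_le (by exact_mod_cast le_top))
      (g.contDiff.contDiffAt.of_le (by exact_mod_cast le_top))
  map_smul' c f := by
    ext1 x
    exact iteratedFDeriv_const_smul_apply (f.contDiff.contDiffAt.of_le (by exact_mod_cast le_top))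

/-- The Fréchet topology: uniform convergence on compact sets of all derivatives. -/
instance : TopologicalSpace (VectorField d) :=
  ⨅ k : ℕ, TopologicalSpace.induced (iteratedDerivative k) inferInstance

instance : IsTopologicalAddGroup (VectorField d) :=
  topologicalAddGroup_iInf fun k => topologicalAddGroup_induced (iteratedDerivative (d := d) k)

instance : ContinuousSMul ℝ (VectorField d) :=
  continuousSMul_iInf fun k => continuousSMul_induced (iteratedDerivative (d := d) k)

/-- The action of an affine transformation `g x = A x + b` on vector fields:
`(g • f) x = A (f (g⁻¹ x))`, with `A` the tangent map of `g`. -/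
def affineAct (g : Space d ≃ᵃ[ℝ] Space d) (f : VectorField d) : VectorField d :=
  ⟨fun x => g.linear (f (g.symm x)), by
    have h₁ : ContDiff ℝ ∞ (g.linear : Space d → Space d) :=
      g.linear.toContinuousLinearEquiv.contDiff
    have h₂ : ContDiff ℝ ∞ (g.symm : Space d → Space d) :=
      ContinuousAffineMap.contDiff
        ⟨g.symm.toAffineMap, AffineMap.continuous_of_finiteDimensional _⟩
    exact h₁.comp (f.contDiff.comp h₂)⟩

end VectorField

/-! ### Local equivariant symmetric multilinear maps -/

/-- The group `G = H ⋉ ℝ^d` of the affine transformations of `ℝ^d` with linear part in `H`. -/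
def affineGroup {d : ℕ} (H : Subgroup (Space d ≃ₗ[ℝ] Space d)) :
    Subgroup (Space d ≃ᵃ[ℝ] Space d) :=
  H.comap AffineEquiv.linearHom

/-- The space of continuous symmetric `m`-linear maps on vector fields that are
equivariant under `G = H ⋉ ℝ^d` and local, i.e. support non-increasing; here an `m`-tuple of
vector fields is regarded as one section of the `m`-fold Whitney sum of the tangent bundle. -/
def localEquivariantMaps {d : ℕ} (H : Subgroup (Space d ≃ₗ[ℝ] Space d)) (m : ℕ) :
    Submodule ℝ (ContinuousMultilinearMap ℝ (fun _ : Fin m => VectorField d) (VectorField d)) where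
  carrier := {φ |
    (∀ (σ : Equiv.Perm (Fin m)) (f : Fin m → VectorField d), φ (fun i => f (σ i)) = φ f) ∧
    (∀ f : Fin m → VectorField d, tsupport (φ f) ⊆ tsupport (fun x (i : Fin m) => f i x)) ∧
    (∀ g ∈ affineGroup H, ∀ f : Fin m → VectorField d,
      φ (fun i => (f i).affineAct g) = (φ f).affineAct g)}
  add_mem' := by
    rintro φ ψ ⟨h₁, h₂, h₃⟩ ⟨k₁, k₂, k₃⟩
    refine ⟨fun σ f => ?_, fun f => ?_, fun g hg f => ?_⟩
    · simp [h₁ σ f, k₁ σ f]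
    · exact (tsupport_add (φ f : Space d → Space d) (ψ f)).trans (Set.union_subset (h₂ f) (k₂ f))
    · simp only [add_apply, h₃ g hg f, k₃ g hg f]
      exact Subtype.ext (funext fun x => (map_add g.linear _ _).symm)
  zero_mem' := by
    refine ⟨fun σ f => rfl, fun f => ?_, fun g hg f => ?_⟩
    · have : tsupport ((0 : VectorField d) : Space d → Space d) = ∅ :=
        tsupport_eq_empty_iff.mpr rfl
      exact this.le.trans (Set.empty_subset _)
    · exact Subtype.ext (funext fun x => (map_zero g.linear).symm)
  smul_mem' := by
    rintro c φ ⟨h₁, h₂, h₃⟩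
    refine ⟨fun σ f => ?_, fun f => ?_, fun g hg f => ?_⟩
    · simp [h₁ σ f]
    · refine (closure_mono ?_).trans (h₂ f)
      exact Function.support_const_smul_subset c (φ f : Space d → Space d)
    · simp only [smul_apply, h₃ g hg f]
      exact Subtype.ext (funext fun x => (map_smul g.linear c _).symm)

/-! ### Symmetric powers -/

section SymmetricPower

variable {V W : Type} [AddCommMonoid V] [Module ℝ V] [AddCommMonoid W] [Module ℝ W] {n : ℕ}

/-- The linear map on the symmetric power induced by a symmetric multilinear map. -/
def symLift (g : MultilinearMap ℝ (fun _ : Fin n => V) W)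
    (hg : ∀ (σ : Equiv.Perm (Fin n)) (v : Fin n → V), g (fun i => v (σ i)) = g v) :
    Sym[ℝ]^n V →ₗ[ℝ] W where
  __ := AddCon.lift (addConGen (SymmetricPower.Rel ℝ (Fin n) V))
    (PiTensorProduct.lift g).toAddMonoidHom (AddCon.addConGen_le.mpr (by
      rintro _ _ ⟨σ, v⟩
      refine (AddCon.ker_rel _).mpr ?_
      rw [LinearMap.toAddMonoidHom_coe, PiTensorProduct.lift.tprod, PiTensorProduct.lift.tprod,
        hg σ v]))
  map_smul' c x := AddCon.induction_on x fun x => map_smul (PiTensorProduct.lift g) c x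

@[simp]
theorem symLift_tprod (g : MultilinearMap ℝ (fun _ : Fin n => V) W)
    (hg : ∀ (σ : Equiv.Perm (Fin n)) (v : Fin n → V), g (fun i => v (σ i)) = g v)
    (v : Fin n → V) : symLift g hg (SymmetricPower.tprod ℝ v) = g v :=
  PiTensorProduct.lift.tprod (φ := g) v

theorem sym_hom_ext {p q : Sym[ℝ]^n V →ₗ[ℝ] W}
    (h : ∀ v : Fin n → V, p (SymmetricPower.tprod ℝ v) = q (SymmetricPower.tprod ℝ v)) : p = q :=
  LinearMap.ext_on_range (SymmetricPower.span_tprod_eq_top ℝ (Fin n) V) h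

/-- Functoriality of the symmetric power. -/
def symMap (n : ℕ) (p : V →ₗ[ℝ] W) : Sym[ℝ]^n V →ₗ[ℝ] Sym[ℝ]^n W :=
  symLift ((SymmetricPower.tprod ℝ).compLinearMap fun _ => p) fun σ v =>
    SymmetricPower.tprod_equiv σ fun i => p (v i)

@[simp]
theorem symMap_tprod (p : V →ₗ[ℝ] W) (v : Fin n → V) :
    symMap n p (SymmetricPower.tprod ℝ v) = SymmetricPower.tprod ℝ fun i => p (v i) :=
  symLift_tprod _ _ v

/-- The action of a group on the symmetric power of a representation. -/
def symRep {G : Type} [Group G] (n : ℕ) (ρ : Representation ℝ G V) :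
    Representation ℝ G (Sym[ℝ]^n V) where
  toFun g := symMap n (ρ g)
  map_one' := sym_hom_ext fun v => by simp
  map_mul' g h := sym_hom_ext fun v => by simp

/-- A linear form `l` on `V` extended multiplicatively: `v₁ ⋯ vₙ ↦ l v₁ * ⋯ * l vₙ`. -/
def symEval (n : ℕ) (l : V →ₗ[ℝ] ℝ) : Sym[ℝ]^n V →ₗ[ℝ] ℝ :=
  symLift ((MultilinearMap.mkPiAlgebra ℝ (Fin n) ℝ).compLinearMap fun _ => l) fun σ v => by
    simpa using Equiv.prod_comp σ fun i => l (v i)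

end SymmetricPower

/-! ### Compositions and the spaces of symmetries -/

/-- A composition: a finitely supported map `ℕ → ℕ`. -/
abbrev NatComposition : Type := ℕ →₀ ℕ

/-- The size `|κ| = ∑ j, κ j`. -/
def NatComposition.size (κ : NatComposition) : ℕ := κ.sum fun _ n => n

/-- The derived composition `κ' j = j * κ j`. -/
def NatComposition.derived (κ : NatComposition) : NatComposition :=
  Finsupp.onFinset κ.support (fun j => j * κ j) fun _ hj =>
    Finsupp.mem_support_iff.mpr (right_ne_zero_of_mul hj)

/-- `M* ⊗ sym^j M` with `M = ℝ^d`. -/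
abbrev Factor (d j : ℕ) : Type := Module.Dual ℝ (Space d) ⊗[ℝ] Sym[ℝ]^j (Space d)

/-- `Sym_κ = M ⊗ ⨂_j sym^{κ j} (M* ⊗ sym^j M)`. The factors with `κ j = 0` are copies of `ℝ` and
are left out. -/
abbrev SymSpace (d : ℕ) (κ : NatComposition) : Type :=
  Space d ⊗[ℝ] (⨂[ℝ] j : κ.support, Sym[ℝ]^(κ j) (Factor d j))

/-- The defining representation of `H` on `M = ℝ^d`. -/
def stdRep {d : ℕ} (H : Subgroup (Space d ≃ₗ[ℝ] Space d)) : Representation ℝ H (Space d) where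
  toFun A := (A : Space d ≃ₗ[ℝ] Space d).toLinearMap
  map_one' := rfl
  map_mul' _ _ := rfl

/-- The tensor product action of `H` on `M* ⊗ sym^j M`. -/
def factorRep {d : ℕ} (H : Subgroup (Space d ≃ₗ[ℝ] Space d)) (j : ℕ) :
    Representation ℝ H (Factor d j) :=
  (stdRep H).dual.tprod (symRep j (stdRep H))

/-- The tensor product action of `H` on `⨂_j sym^{κ j} (M* ⊗ sym^j M)`. -/
def productRep {d : ℕ} (H : Subgroup (Space d ≃ₗ[ℝ] Space d)) (κ : NatComposition) :
    Representation ℝ H (⨂[ℝ] j : κ.support, Sym[ℝ]^(κ j) (Factor d j)) where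
  toFun A := PiTensorProduct.map fun j : κ.support => symRep (κ j) (factorRep H j) A
  map_one' := by simp only [map_one]; exact PiTensorProduct.map_one
  map_mul' A B := by simp only [map_mul]; exact PiTensorProduct.map_mul _ _

/-- The tensor product action of `H` on `Sym_κ`. -/
def symSpaceRep {d : ℕ} (H : Subgroup (Space d ≃ₗ[ℝ] Space d)) (κ : NatComposition) :
    Representation ℝ H (SymSpace d κ) :=
  (stdRep H).tprod (productRep H κ)

/-! ### Contraction with the jet of a vector field at the origin -/

theorem iteratedFDeriv_perm {E F : Type} [NormedAddCommGroup E] [NormedSpace ℝ E]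
    [NormedAddCommGroup F] [NormedSpace ℝ F] {f : E → F} (hf : ContDiff ℝ ∞ f) (n : ℕ) (x : E)
    (σ : Equiv.Perm (Fin n)) (v : Fin n → E) :
    iteratedFDeriv ℝ n f x (fun i => v (σ i)) = iteratedFDeriv ℝ n f x v := by
  have hd : ∀ k : ℕ, ContDiff ℝ ∞ (iteratedFDeriv ℝ k f) := fun k =>
    hf.iteratedFDeriv_right (m := ∞) (by exact_mod_cast le_top)
  induction n generalizing x with
  | zero => exact congrArg _ (Subsingleton.elim _ _)
  | succ n ih =>
    have tail : ∀ (τ : Equiv.Perm (Fin n)) (w : Fin (n + 1) → E) (y : E),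
        iteratedFDeriv ℝ (n + 1) f y (Fin.cons (w 0) fun i => w (τ i).succ) =
          iteratedFDeriv ℝ (n + 1) f y w := by
      intro τ w y
      have hdiff : DifferentiableAt ℝ (iteratedFDeriv ℝ n f) y :=
        (hd n).differentiable (by simp) y
      have key : ∀ u : Fin n → E,
          fderiv ℝ (iteratedFDeriv ℝ n f) y (w 0) u =
            fderiv ℝ (fun z => iteratedFDeriv ℝ n f z u) y (w 0) := by
        intro u
        rw [fderiv_continuousMultilinear_apply_const_apply hdiff]
      rw [iteratedFDeriv_succ_apply_left, iteratedFDeriv_succ_apply_left]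
      simp only [Fin.cons_zero, Fin.tail_cons]
      rw [key, key]
      congr 2
      funext z
      exact ih z τ (Fin.tail w)
    have hσ : σ ∈ Submonoid.closure
        (Set.range fun i : Fin n => Equiv.swap i.castSucc i.succ) := by
      rw [Equiv.Perm.mclosure_swap_castSucc_succ]; trivial
    induction hσ using Submonoid.closure_induction generalizing v with
    | one => rfl
    | mul a b _ _ ha hb => exact (hb fun i => v (a i)).trans (ha v)
    | mem τ hτ =>
      obtain ⟨i, rfl⟩ := hτ
      obtain ⟨n, rfl⟩ : ∃ k, n = k + 1 := ⟨n - 1, by have := i.2; omega⟩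
      refine Fin.cases ?_ (fun j => ?_) i
      · have hs := ((hd n).contDiffAt (x := x)).isSymmSndFDerivAt
          (by rw [minSmoothness_of_isRCLikeNormedField]; exact WithTop.coe_le_coe.mpr (le_top (a := (2 : ℕ∞))))
        have two : ∀ w : Fin (n + 2) → E, iteratedFDeriv ℝ (n + 2) f x w =
            fderiv ℝ (fderiv ℝ (iteratedFDeriv ℝ n f)) x (w 0) (w 1) (Fin.tail (Fin.tail w)) := by
          intro w
          have hdiff : DifferentiableAt ℝ (iteratedFDeriv ℝ (n + 1) f) x :=
            (hd (n + 1)).differentiable (by simp) x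
          have hdiff' : DifferentiableAt ℝ (fderiv ℝ (iteratedFDeriv ℝ n f)) x :=
            ((hd n).fderiv_right (m := ∞) (by simp)).differentiable (by simp) x
          have hdiff'' : DifferentiableAt ℝ
              (fun z => fderiv ℝ (iteratedFDeriv ℝ n f) z (w 1)) x :=
            hdiff'.clm_apply (differentiableAt_const _)
          rw [iteratedFDeriv_succ_apply_left,
            ← fderiv_continuousMultilinear_apply_const_apply hdiff]
          simp only [iteratedFDeriv_succ_apply_left]
          change fderiv ℝ (fun z => fderiv ℝ (iteratedFDeriv ℝ n f) z (w 1)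
            (Fin.tail (Fin.tail w))) x (w 0) = _
          rw [fderiv_continuousMultilinear_apply_const_apply hdiff'',
            fderiv_clm_apply hdiff' (differentiableAt_const _)]
          simp
        rw [two, two]
        have h0 : Equiv.swap (Fin.castSucc (0 : Fin (n + 1))) (Fin.succ 0) 0 = 1 := by
          simp
        have h1 : Equiv.swap (Fin.castSucc (0 : Fin (n + 1))) (Fin.succ 0) 1 = 0 := by
          simp
        simp only [h0, h1]
        rw [hs.eq]
        congr 1
      · rw [← tail (Equiv.swap j.castSucc j.succ) v x]
        congr 1
        funext k
        refine Fin.cases ?_ (fun l => ?_) k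
        · rw [Fin.cons_zero, Equiv.swap_apply_of_ne_of_ne] <;> simp [Fin.ext_iff]
        · refine congrArg v ?_
          exact ((Fin.succ_injective _).swap_apply j.castSucc j.succ l)

/-- The `j`-th derivative of `f` at the origin as a linear map `sym^j M → M`. -/
def taylorCoeff {d : ℕ} (f : VectorField d) (j : ℕ) : Sym[ℝ]^j (Space d) →ₗ[ℝ] Space d :=
  symLift (iteratedFDeriv ℝ j f 0).toMultilinearMap fun σ v =>
    iteratedFDeriv_perm f.contDiff j 0 σ v

/-- The contraction `ξ ⊗ s ↦ ξ (f^(j)(0) s)` of `M* ⊗ sym^j M` with `f^(j)(0)`. -/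
def factorEval {d : ℕ} (f : VectorField d) (j : ℕ) : Factor d j →ₗ[ℝ] ℝ :=
  contractLeft ℝ (Space d) ∘ₗ LinearMap.lTensor (Module.Dual ℝ (Space d)) (taylorCoeff f j)

/-- The contraction of an element of `Sym_κ` with `κ j` copies of `f^(j)(0)` for each `j`. -/
def symSpaceEval {d : ℕ} (f : VectorField d) (κ : NatComposition) : SymSpace d κ →ₗ[ℝ] Space d :=
  (TensorProduct.rid ℝ (Space d)).toLinearMap ∘ₗ
    LinearMap.lTensor (Space d)
      (PiTensorProduct.lift ((MultilinearMap.mkPiAlgebra ℝ κ.support ℝ).compLinearMap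
        fun j : κ.support => symEval (κ j) (factorEval f j)))

end LocalEquivariant

end

open LocalEquivariant

/-!
An equivariant map `φ` is determined by its values at the origin, by translation, and by
polarization these are determined by `f ↦ φ(f, …, f)(0)`. A scaling `c` with `|c| ≠ 1` turns
`φ(f₁, …, f_m)(0)` into `t ^ (1 - m) φ(f₁(t ·), …, f_m(t ·))(0)` for `t = c ^ k`. If the
derivatives of order less than `m` of some `f_i` vanish at the origin, then `t ^ (1 - m) f_i(t ·)
→ 0` as `t → 0`, and continuity of `φ` gives the value `0`. Hence the value at the origin only
depends on the Taylor polynomials of degree less than `m`, which gives locality, and the diagonal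
is a sum of contractions `⟨S_κ, f⟩` with `|κ| = m`.

Contractions with distinct `κ` are linearly independent as functions of the jet of `f`. Therefore
the `S_κ` inherit the `H`-invariance of `φ`, and invariance under the scaling `c` kills those with
`|κ'| ≠ m - 1`. Conversely, the polarization of an invariant contraction, applied to the
translates of `f₁, …, f_m`, is a smooth vector field which depends continuously on `f₁, …, f_m`.
-/

open scoped ContDiff TensorProduct DirectSum

noncomputable section

namespace LocalEquivariant

open Filter Topology

/-! ### Polarization -/

section Polarization

variable {ι : Type*} [Fintype ι] [DecidableEq ι]

theorem sum_superset_neg_one_pow_card_compl (U : Finset ι) :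
    ∑ T with U ⊆ T, (-1 : ℤ) ^ Tᶜ.card = if U = Finset.univ then 1 else 0 := by
  simp only [← Finset.compl_eq_empty_iff, ← Finset.sum_powerset_neg_one_pow_card]
  refine Finset.sum_nbij' (·ᶜ) (·ᶜ) ?_ ?_ ?_ ?_ ?_ <;>
    simp +contextual [Finset.subset_compl_comm]

theorem sum_bijective_eq_sum_perm {W : Type*} [AddCommMonoid W] (F : (ι → ι) → W) :
    ∑ r with Function.Bijective r, F r = ∑ σ : Equiv.Perm ι, F σ :=
  (Finset.sum_bij' (fun (σ : Equiv.Perm ι) _ => (σ : ι → ι))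
    (fun r hr => Equiv.ofBijective r (Finset.mem_filter.mp hr).2) (by simp) (by simp)
    (fun σ _ => Equiv.ext fun _ => rfl) (fun _ _ => rfl) (fun _ _ => rfl)).symm

variable {R V W : Type*} [Semiring R] [AddCommMonoid V] [Module R V] [AddCommGroup W] [Module R W]

theorem map_const_sum_eq_sum_filter (g : MultilinearMap R (fun _ : ι => V) W) (x : ι → V)
    (T : Finset ι) :
    g (fun _ => ∑ c ∈ T, x c) =
      ∑ r : ι → ι with Finset.univ.image r ⊆ T, g (fun i => x (r i)) := by
  rw [g.map_sum_finset (fun _ c => x c) fun _ => T]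
  refine Finset.sum_congr ?_ fun _ _ => rfl
  ext r
  simp [Fintype.mem_piFinset, Finset.image_subset_iff]

theorem sum_map_const_sum_eq_sum_perm (g : MultilinearMap R (fun _ : ι => V) W) (x : ι → V) :
    ∑ T : Finset ι, (-1 : ℤ) ^ Tᶜ.card • g (fun _ => ∑ c ∈ T, x c) =
      ∑ σ : Equiv.Perm ι, g (fun i => x (σ i)) := by
  have image_eq_univ (r : ι → ι) : Finset.univ.image r = Finset.univ ↔ Function.Bijective r := by
    rw [← Finite.surjective_iff_bijective]
    simp [Finset.ext_iff, Function.Surjective]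
  calc ∑ T : Finset ι, (-1 : ℤ) ^ Tᶜ.card • g (fun _ => ∑ c ∈ T, x c)
      = ∑ r : ι → ι, (∑ T with Finset.univ.image r ⊆ T, (-1 : ℤ) ^ Tᶜ.card) •
          g (fun i => x (r i)) := by
        simp only [map_const_sum_eq_sum_filter, Finset.smul_sum, Finset.sum_smul,
          Finset.sum_filter, smul_ite, ite_smul, smul_zero, zero_smul]
        exact Finset.sum_comm
    _ = ∑ r : ι → ι with Function.Bijective r, g (fun i => x (r i)) := by
        simp only [sum_superset_neg_one_pow_card_compl, image_eq_univ, ite_smul, one_smul,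
          zero_smul]
        rw [Finset.sum_filter]
    _ = ∑ σ : Equiv.Perm ι, g (fun i => x (σ i)) :=
        sum_bijective_eq_sum_perm fun r => g fun i => x (r i)

end Polarization

theorem eq_zero_of_map_const_eq_zero {R V W ι : Type*} [Semiring R] [AddCommMonoid V] [Module R V]
    [AddCommGroup W] [Module R W] [IsAddTorsionFree W] [Finite ι]
    (g : MultilinearMap R (fun _ : ι => V) W)
    (hsymm : ∀ (σ : Equiv.Perm ι) (v : ι → V), g (fun i => v (σ i)) = g v)
    (hdiag : ∀ v, g (fun _ => v) = 0) : g = 0 := by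
  classical
  cases nonempty_fintype ι
  ext v
  have polarized := sum_map_const_sum_eq_sum_perm g v
  simp only [hdiag, smul_zero, Finset.sum_const_zero, hsymm, Finset.sum_const, Finset.card_univ,
    Fintype.card_perm] at polarized
  exact (nsmul_eq_zero_iff_right (Nat.factorial_ne_zero _)).mp polarized.symm

theorem map_eq_sum_coord_smul {R V W κ ι : Type*} [CommSemiring R] [AddCommMonoid V] [Module R V]
    [AddCommMonoid W] [Module R W] [Fintype κ] [Fintype ι] [DecidableEq ι]
    (b : Module.Basis κ R V) (g : MultilinearMap R (fun _ : ι => V) W) (v : ι → V) :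
    g v = ∑ i : ι → κ, (∏ k, b.coord (i k) (v k)) • g fun k => b (i k) := by
  conv_lhs => enter [2, k]; rw [← b.sum_repr (v k)]
  rw [g.map_sum]
  exact Finset.sum_congr rfl fun i _ => g.map_smul_univ _ _

/-! ### Contractions with powers of linear forms -/

section Contraction

@[simp]
theorem symEval_tprod {V : Type} [AddCommMonoid V] [Module ℝ V] {n : ℕ} (l : V →ₗ[ℝ] ℝ)
    (v : Fin n → V) : symEval n l (SymmetricPower.tprod ℝ v) = ∏ i, l (v i) := by
  simp [symEval]

theorem symEval_smul {V : Type} [AddCommMonoid V] [Module ℝ V] {n : ℕ} (c : ℝ) (l : V →ₗ[ℝ] ℝ) :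
    symEval n (c • l) = c ^ n • symEval n l :=
  sym_hom_ext fun v => by simp [Finset.prod_mul_distrib]

theorem symEval_comp_symMap {V W : Type} [AddCommMonoid V] [Module ℝ V] [AddCommMonoid W]
    [Module ℝ W] {n : ℕ} (l : W →ₗ[ℝ] ℝ) (p : V →ₗ[ℝ] W) :
    symEval n l ∘ₗ symMap n p = symEval n (l ∘ₗ p) :=
  sym_hom_ext fun v => by simp

variable {V : Type} [AddCommMonoid V] [Module ℝ V] {n : ℕ}

theorem sum_prod_sum_apply_eq_permanent (l : Fin n → V →ₗ[ℝ] ℝ) (v : Fin n → V) :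
    ∑ T : Finset (Fin n), (-1 : ℝ) ^ Tᶜ.card * ∏ k, (∑ c ∈ T, l c) (v k) =
      ∑ σ : Equiv.Perm (Fin n), ∏ k, l k (v (σ k)) := by
  let g : MultilinearMap ℝ (fun _ : Fin n => V →ₗ[ℝ] ℝ) ℝ :=
    (MultilinearMap.mkPiAlgebra ℝ (Fin n) ℝ).compLinearMap fun k => LinearMap.applyₗ (v k)
  calc ∑ T : Finset (Fin n), (-1 : ℝ) ^ Tᶜ.card * ∏ k, (∑ c ∈ T, l c) (v k)
      = ∑ σ : Equiv.Perm (Fin n), ∏ k, l (σ k) (v k) := by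
        simpa [g] using sum_map_const_sum_eq_sum_perm g l
    _ = ∑ σ : Equiv.Perm (Fin n), ∏ k, l k (v (σ⁻¹ k)) :=
        Finset.sum_congr rfl fun σ _ => by
          rw [← Equiv.prod_comp σ fun k => l k (v (σ⁻¹ k))]
          simp
    _ = ∑ σ : Equiv.Perm (Fin n), ∏ k, l k (v (σ k)) :=
        Equiv.sum_comp (Equiv.inv _) fun σ : Equiv.Perm (Fin n) => ∏ k, l k (v (σ k))

theorem sum_symEval_smul_tprod_basis {κ : Type} [Fintype κ] (b : Module.Basis κ ℝ V)
    (s : Sym[ℝ]^n V) :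
    ∑ a : (Fin n → κ) × Finset (Fin n), ((-1 : ℝ) ^ (a.2)ᶜ.card *
        symEval n (∑ c ∈ a.2, b.coord (a.1 c)) s) • SymmetricPower.tprod ℝ (fun k => b (a.1 k)) =
      n.factorial • s := by
  suffices h : ∑ a : (Fin n → κ) × Finset (Fin n),
      ((-1 : ℝ) ^ (a.2)ᶜ.card • symEval n (∑ c ∈ a.2, b.coord (a.1 c))).smulRight
        (SymmetricPower.tprod ℝ fun k => b (a.1 k)) = n.factorial • LinearMap.id by
    simpa using LinearMap.congr_fun h s
  refine sym_hom_ext fun v => ?_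
  have permanent (i : Fin n → κ) := sum_prod_sum_apply_eq_permanent (fun c => b.coord (i c)) v
  have expand (σ : Equiv.Perm (Fin n)) :=
    map_eq_sum_coord_smul b (SymmetricPower.tprod ℝ) fun k => v (σ k)
  simp only [LinearMap.coe_sum, Finset.sum_apply] at permanent
  simp only [LinearMap.coe_sum, Finset.sum_apply, LinearMap.smulRight_apply, LinearMap.smul_apply,
    symEval_tprod, Fintype.sum_prod_type, smul_eq_mul, ← Finset.sum_smul, permanent,
    LinearMap.id_apply]
  simp only [Finset.sum_smul]
  rw [Finset.sum_comm]
  simp only [← expand, SymmetricPower.tprod_equiv, Finset.sum_const, Finset.card_univ,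
    Fintype.card_perm, Fintype.card_fin]

instance finite_symmetricPower {V : Type} [AddCommGroup V] [Module ℝ V] [Module.Finite ℝ V] :
    Module.Finite ℝ (Sym[ℝ]^n V) :=
  Module.Finite.of_surjective (SymmetricPower.mk ℝ (Fin n) V)
    (LinearMap.range_eq_top.mp (SymmetricPower.range_mk ..))

theorem exists_eq_sum_symEval_smul (V : Type) [AddCommMonoid V] [Module ℝ V] [Module.Free ℝ V]
    [Module.Finite ℝ V] (n : ℕ) :
    ∃ (α : Type) (_ : Fintype α) (l : α → V →ₗ[ℝ] ℝ) (w : α → Sym[ℝ]^n V),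
      ∀ s, s = ∑ a, symEval n (l a) s • w a := by
  let b := Module.Free.chooseBasis ℝ V
  refine ⟨(Fin n → Module.Free.ChooseBasisIndex ℝ V) × Finset (Fin n), inferInstance,
    fun a => ∑ c ∈ a.2, b.coord (a.1 c),
    fun a => ((n.factorial : ℝ)⁻¹ * (-1) ^ (a.2)ᶜ.card) •
      SymmetricPower.tprod ℝ fun k => b (a.1 k), fun s => ?_⟩
  have hn : (n.factorial : ℝ) ≠ 0 := by exact_mod_cast n.factorial_ne_zero
  calc s = (n.factorial : ℝ)⁻¹ • n.factorial • s := by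
        rw [← Nat.cast_smul_eq_nsmul ℝ, inv_smul_smul₀ hn]
    _ = _ := by
        rw [← sum_symEval_smul_tprod_basis b s, Finset.smul_sum]
        simp only [smul_smul]
        exact Finset.sum_congr rfl fun a _ => by ring_nf

variable {ι : Type} [Fintype ι] {V : ι → Type} [∀ i, AddCommMonoid (V i)] [∀ i, Module ℝ (V i)]
  {n : ι → ℕ} {M : Type} [AddCommMonoid M] [Module ℝ M]

/-- The contraction of `⨂_i sym^{n i} (V i)` with the powers of a family of linear forms. -/
def prodEval (n : ι → ℕ) (l : ∀ i, V i →ₗ[ℝ] ℝ) : (⨂[ℝ] i, Sym[ℝ]^(n i) (V i)) →ₗ[ℝ] ℝ :=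
  PiTensorProduct.lift ((MultilinearMap.mkPiAlgebra ℝ ι ℝ).compLinearMap
    fun i => symEval (n i) (l i))

@[simp]
theorem prodEval_tprod (l : ∀ i, V i →ₗ[ℝ] ℝ) (s : ∀ i, Sym[ℝ]^(n i) (V i)) :
    prodEval n l (PiTensorProduct.tprod ℝ s) = ∏ i, symEval (n i) (l i) (s i) := by
  simp [prodEval]

/-- The contraction of `M ⊗ ⨂_i sym^{n i} (V i)` with the powers of a family of linear forms. -/
def contract (M : Type) [AddCommMonoid M] [Module ℝ M] (n : ι → ℕ) (l : ∀ i, V i →ₗ[ℝ] ℝ) :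
    M ⊗[ℝ] (⨂[ℝ] i, Sym[ℝ]^(n i) (V i)) →ₗ[ℝ] M :=
  (TensorProduct.rid ℝ M).toLinearMap ∘ₗ LinearMap.lTensor M (prodEval n l)

@[simp]
theorem contract_tmul (l : ∀ i, V i →ₗ[ℝ] ℝ) (x : M) (s : ⨂[ℝ] i, Sym[ℝ]^(n i) (V i)) :
    contract M n l (x ⊗ₜ s) = prodEval n l s • x := by
  simp [contract]

theorem tensor_hom_ext {ι M N : Type} [AddCommMonoid M] [Module ℝ M] [AddCommMonoid N]
    [Module ℝ N] {P : ι → Type} [∀ i, AddCommMonoid (P i)] [∀ i, Module ℝ (P i)]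
    {p q : M ⊗[ℝ] (⨂[ℝ] i, P i) →ₗ[ℝ] N}
    (h : ∀ x s, p (x ⊗ₜ PiTensorProduct.tprod ℝ s) = q (x ⊗ₜ PiTensorProduct.tprod ℝ s)) :
    p = q :=
  TensorProduct.ext (LinearMap.ext fun x => PiTensorProduct.ext (MultilinearMap.ext (h x)))

theorem contract_smul (c : ι → ℝ) (l : ∀ i, V i →ₗ[ℝ] ℝ) :
    contract M n (fun i => c i • l i) = (∏ i, c i ^ n i) • contract M n l :=
  tensor_hom_ext fun x s => by simp [symEval_smul, Finset.prod_mul_distrib, smul_smul]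

theorem contract_map_map {N : Type} [AddCommMonoid N] [Module ℝ N] {W : ι → Type}
    [∀ i, AddCommMonoid (W i)] [∀ i, Module ℝ (W i)] (q : M →ₗ[ℝ] N)
    (p : ∀ i, V i →ₗ[ℝ] W i) (l : ∀ i, W i →ₗ[ℝ] ℝ)
    (S : M ⊗[ℝ] (⨂[ℝ] i, Sym[ℝ]^(n i) (V i))) :
    contract N n l (TensorProduct.map q (PiTensorProduct.map fun i => symMap (n i) (p i)) S) =
      q (contract M n (fun i => l i ∘ₗ p i) S) := by
  have comp_eq : contract N n l ∘ₗ
      TensorProduct.map q (PiTensorProduct.map fun i => symMap (n i) (p i)) =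
        q ∘ₗ contract M n (fun i => l i ∘ₗ p i) :=
    tensor_hom_ext fun x s => by simp [← symEval_comp_symMap]
  exact LinearMap.congr_fun comp_eq S

variable [∀ i, Module.Free ℝ (V i)] [∀ i, Module.Finite ℝ (V i)]

theorem exists_eq_sum_prodEval_smul (n : ι → ℕ) :
    ∃ (α : Type) (_ : Fintype α) (l : α → ∀ i, V i →ₗ[ℝ] ℝ) (w : α → ⨂[ℝ] i, Sym[ℝ]^(n i) (V i)),
      LinearMap.id = ∑ a, (prodEval n (l a)).smulRight (w a) := by
  classical
  choose α _ l w hw using fun i => exists_eq_sum_symEval_smul (V i) (n i)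
  refine ⟨∀ i, α i, inferInstance, fun a i => l i (a i),
    fun a => PiTensorProduct.tprod ℝ fun i => w i (a i),
    PiTensorProduct.ext (MultilinearMap.ext fun s => ?_)⟩
  suffices PiTensorProduct.tprod ℝ s = ∑ a : ∀ i, α i,
      (∏ i, symEval (n i) (l i (a i)) (s i)) • PiTensorProduct.tprod ℝ fun i => w i (a i) by
    simpa using this
  conv_lhs => enter [2, i]; rw [hw i (s i)]
  rw [MultilinearMap.map_sum]
  exact Finset.sum_congr rfl fun a _ => MultilinearMap.map_smul_univ _ _ _

omit [Fintype ι] in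
instance finite_piTensorProduct_symmetricPower [Finite ι] :
    Module.Finite ℝ (⨂[ℝ] i, Sym[ℝ]^(n i) (V i)) := by
  cases nonempty_fintype ι
  obtain ⟨α, _, l, w, hw⟩ := exists_eq_sum_prodEval_smul (V := V) n
  refine Module.Finite.of_surjective (Fintype.linearCombination ℝ w) fun s =>
    ⟨fun a => prodEval n (l a) s, ?_⟩
  simpa [Fintype.linearCombination_apply] using (LinearMap.congr_fun hw s).symm

theorem eq_zero_of_contract_eq_zero {S : M ⊗[ℝ] (⨂[ℝ] i, Sym[ℝ]^(n i) (V i))}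
    (h : ∀ l, contract M n l S = 0) : S = 0 := by
  obtain ⟨α, _, l, w, hw⟩ := exists_eq_sum_prodEval_smul (V := V) n
  have resolution : LinearMap.id =
      ∑ a, (TensorProduct.mk ℝ M _).flip (w a) ∘ₗ contract M n (l a) := by
    refine TensorProduct.ext' fun x s => ?_
    have hs : s = ∑ a, prodEval n (l a) s • w a := by
      simpa using LinearMap.congr_fun hw s
    calc x ⊗ₜ s = ∑ a, prodEval n (l a) s • x ⊗ₜ w a := by
          conv_lhs => rw [hs, TensorProduct.tmul_sum]
          simp only [TensorProduct.tmul_smul]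
      _ = _ := by simp
  simpa [h] using LinearMap.congr_fun resolution S

end Contraction

theorem symSpaceEval_eq_contract {d : ℕ} (f : VectorField d) (κ : NatComposition) :
    symSpaceEval f κ = contract (Space d) (fun j : κ.support => κ j) fun j => factorEval f j := rfl

section Range

variable {X : Type*} {V : Type} [AddCommMonoid V] [Module ℝ V]

theorem range_pi_symEval (l : X → V →ₗ[ℝ] ℝ) (n : ℕ) :
    LinearMap.range (LinearMap.pi fun x => symEval n (l x)) =
      LinearMap.range (LinearMap.pi l) ^ n := by
  have eval_tprod (v : Fin n → V) : LinearMap.pi (fun x => symEval n (l x))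
      (SymmetricPower.tprod ℝ v) = (List.ofFn fun i => LinearMap.pi l (v i)).prod := by
    ext x
    simp [List.prod_ofFn]
  apply le_antisymm
  · rw [LinearMap.range_eq_map, ← SymmetricPower.span_tprod_eq_top, Submodule.map_span_le]
    rintro _ ⟨v, rfl⟩
    rw [Submodule.pow_eq_span_pow_set, eval_tprod]
    exact Submodule.subset_span (Set.mem_pow.mpr ⟨fun i => ⟨_, v i, rfl⟩, rfl⟩)
  · rw [Submodule.pow_eq_span_pow_set, Submodule.span_le]
    intro a ha
    obtain ⟨g, rfl⟩ := Set.mem_pow.mp ha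
    choose v hv using fun i => (g i).2
    exact ⟨SymmetricPower.tprod ℝ v, by simp only [eval_tprod, hv]⟩

variable {ι : Type} [Fintype ι] {V : ι → Type} [∀ i, AddCommMonoid (V i)] [∀ i, Module ℝ (V i)]

open scoped Pointwise in
theorem range_pi_prodEval (l : X → ∀ i, V i →ₗ[ℝ] ℝ) (n : ι → ℕ) :
    LinearMap.range (LinearMap.pi fun x => prodEval n (l x)) =
      ∏ i, LinearMap.range (LinearMap.pi fun x => l x i) ^ n i := by
  have eval_tprod (s : ∀ i, Sym[ℝ]^(n i) (V i)) : LinearMap.pi (fun x => prodEval n (l x))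
      (PiTensorProduct.tprod ℝ s) = ∏ i, LinearMap.pi (fun x => symEval (n i) (l x i)) (s i) := by
    ext x
    simp
  have span_eq : ∏ i, LinearMap.range (LinearMap.pi fun x => l x i) ^ n i = Submodule.span ℝ
      (∏ i, (LinearMap.range (LinearMap.pi fun x => symEval (n i) (l x i)) : Set (X → ℝ))) := by
    rw [← Submodule.prod_span]
    simp [range_pi_symEval]
  rw [span_eq]
  apply le_antisymm
  · rw [LinearMap.range_eq_map, ← PiTensorProduct.span_tprod_eq_top, Submodule.map_span_le]
    rintro _ ⟨s, rfl⟩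
    rw [eval_tprod]
    exact Submodule.subset_span (Set.finsetProd_mem_finsetProd _ _ _ fun i _ => ⟨s i, rfl⟩)
  · rw [Submodule.span_le]
    intro a ha
    obtain ⟨g, hg, rfl⟩ := (Set.mem_finsetProd _ _ _).mp ha
    choose s hs using fun i => hg (Finset.mem_univ i)
    exact ⟨PiTensorProduct.tprod ℝ s, by simp only [eval_tprod, hs]⟩

end Range

/-! ### Vector fields with prescribed jets -/

theorem continuous_multilinearMap {ι V W : Type*} [Finite ι] [NormedAddCommGroup V]
    [NormedSpace ℝ V] [FiniteDimensional ℝ V] [AddCommGroup W] [Module ℝ W] [TopologicalSpace W]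
    [ContinuousAdd W] [ContinuousSMul ℝ W] (q : MultilinearMap ℝ (fun _ : ι => V) W) :
    Continuous q := by
  classical
  cases nonempty_fintype ι
  let b := Module.finBasis ℝ V
  have (i : Fin (Module.finrank ℝ V)) : Continuous (b.coord i) :=
    (b.coord i).continuous_of_finiteDimensional
  have expand : ⇑q = fun v => ∑ i : ι → Fin (Module.finrank ℝ V),
      (∏ k, b.coord (i k) (v k)) • q fun k => b (i k) := funext (map_eq_sum_coord_smul b q)
  rw [expand]
  fun_prop

namespace VectorField

variable {d : ℕ}

/-- The `n`-th derivative of a vector field at a point, as a linear map of the vector field. -/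
def derivativeAt (n : ℕ) (x : Space d) : VectorField d →ₗ[ℝ] (Space d) [×n]→L[ℝ] (Space d) where
  toFun f := iteratedFDeriv ℝ n f x
  map_add' f g := congrArg (· x) (map_add (iteratedDerivative n) f g)
  map_smul' c f := congrArg (· x) (map_smul (iteratedDerivative n) c f)

theorem derivativeAt_apply (n : ℕ) (x : Space d) (f : VectorField d) :
    derivativeAt n x f = iteratedFDeriv ℝ n f x := rfl

/-- Evaluation of vector fields at a point. -/
def eval (x : Space d) : VectorField d →ₗ[ℝ] Space d :=
  LinearMap.proj x ∘ₗ (smoothMaps d).subtype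

@[simp]
theorem eval_apply (x : Space d) (f : VectorField d) : eval x f = f x := rfl

/-- The vector field `x ↦ f (t x)`. -/
def dilate (t : ℝ) (f : VectorField d) : VectorField d :=
  ⟨fun x => f (t • x), f.contDiff.comp (contDiff_id.const_smul t)⟩

theorem iteratedFDeriv_dilate (t : ℝ) (f : VectorField d) (n : ℕ) (x : Space d) :
    iteratedFDeriv ℝ n (f.dilate t) x = t ^ n • iteratedFDeriv ℝ n f (t • x) :=
  congrFun (iteratedFDeriv_comp_const_smul t (f.contDiff.of_le (by exact_mod_cast le_top))) x

/-- The homogeneous polynomial vector field `x ↦ q (x, …, x)`. -/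
def homogeneous {j : ℕ} :
    MultilinearMap ℝ (fun _ : Fin j => Space d) (Space d) →ₗ[ℝ] VectorField d where
  toFun q := ⟨fun x => q fun _ => x, by
    have : ContDiff ℝ ∞ fun (x : Space d) (_ : Fin j) => x := contDiff_pi.mpr fun _ => contDiff_id
    exact (ContinuousMultilinearMap.contDiff ⟨q, continuous_multilinearMap q⟩).comp this⟩
  map_add' _ _ := rfl
  map_smul' _ _ := rfl

theorem dilate_homogeneous {j : ℕ} (t : ℝ)
    (q : MultilinearMap ℝ (fun _ : Fin j => Space d) (Space d)) :
    (homogeneous q).dilate t = t ^ j • homogeneous q :=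
  Subtype.ext (funext fun x => (q.map_smul_univ (fun _ => t) fun _ => x).trans (by
    simp only [Finset.prod_const, Finset.card_univ, Fintype.card_fin]
    rfl))

theorem iteratedFDeriv_homogeneous_of_ne {j n : ℕ} (hnj : n ≠ j)
    (q : MultilinearMap ℝ (fun _ : Fin j => Space d) (Space d)) :
    iteratedFDeriv ℝ n (homogeneous q) 0 = 0 := by
  have scaling : (2 : ℝ) ^ n • iteratedFDeriv ℝ n (homogeneous q) 0 =
      (2 : ℝ) ^ j • iteratedFDeriv ℝ n (homogeneous q) 0 :=
    calc (2 : ℝ) ^ n • iteratedFDeriv ℝ n (homogeneous q) 0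
        = derivativeAt n 0 ((homogeneous q).dilate 2) := by
          rw [derivativeAt_apply, iteratedFDeriv_dilate, smul_zero]
      _ = (2 : ℝ) ^ j • iteratedFDeriv ℝ n (homogeneous q) 0 := by
          rw [dilate_homogeneous, map_smul, derivativeAt_apply]
  rw [← sub_eq_zero, ← sub_smul] at scaling
  refine (smul_eq_zero.mp scaling).resolve_left fun h => hnj ?_
  exact Nat.pow_right_injective le_rfl (by exact_mod_cast sub_eq_zero.mp h)

theorem iteratedFDeriv_homogeneous_self {j : ℕ}
    (q : MultilinearMap ℝ (fun _ : Fin j => Space d) (Space d))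
    (hq : ∀ (σ : Equiv.Perm (Fin j)) (v : Fin j → Space d), q (fun i => v (σ i)) = q v)
    (v : Fin j → Space d) :
    iteratedFDeriv ℝ j (homogeneous q) 0 v = (j.factorial : ℝ) • q v := by
  refine (ContinuousMultilinearMap.iteratedFDeriv_comp_diagonal
    ⟨q, continuous_multilinearMap q⟩ 0 v).trans ?_
  change ∑ σ : Equiv.Perm (Fin j), q (fun i => v (σ i)) = _
  simp [hq, Fintype.card_perm, Nat.cast_smul_eq_nsmul]

/-- The polynomial vector field with derivatives `q j` at the origin for `j ∈ s`. -/
def polynomial (s : Finset ℕ)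
    (q : ∀ j, MultilinearMap ℝ (fun _ : Fin j => Space d) (Space d)) : VectorField d :=
  ∑ j ∈ s, (j.factorial : ℝ)⁻¹ • homogeneous (q j)

theorem iteratedFDeriv_polynomial {s : Finset ℕ} {n : ℕ} (hn : n ∈ s)
    (q : ∀ j, MultilinearMap ℝ (fun _ : Fin j => Space d) (Space d))
    (hq : ∀ j (σ : Equiv.Perm (Fin j)) (v : Fin j → Space d), q j (fun i => v (σ i)) = q j v)
    (v : Fin n → Space d) :
    iteratedFDeriv ℝ n (polynomial s q) 0 v = q n v := by
  have vanish (j : ℕ) (hj : j ≠ n) :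
      (j.factorial : ℝ)⁻¹ • homogeneous (q j) ∈ LinearMap.ker (derivativeAt n 0) :=
    Submodule.smul_mem _ _ (iteratedFDeriv_homogeneous_of_ne hj.symm (q j))
  have single : derivativeAt n 0 (polynomial s q) =
      (n.factorial : ℝ)⁻¹ • iteratedFDeriv ℝ n (homogeneous (q n)) 0 := by
    rw [polynomial, map_sum, Finset.sum_eq_single_of_mem n hn fun j _ hj => vanish j hj,
      map_smul, derivativeAt_apply]
  rw [← derivativeAt_apply, single, smul_apply,
    iteratedFDeriv_homogeneous_self (q n) (hq n),
    inv_smul_smul₀ (by exact_mod_cast n.factorial_ne_zero)]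

/-- The Taylor polynomial at the origin, of degree less than `m`. -/
def taylor (m : ℕ) (f : VectorField d) : VectorField d :=
  polynomial (Finset.range m) fun j => (iteratedFDeriv ℝ j f 0).toMultilinearMap

theorem iteratedFDeriv_taylor {m n : ℕ} (hn : n < m) (f : VectorField d) :
    iteratedFDeriv ℝ n (f.taylor m) 0 = iteratedFDeriv ℝ n f 0 :=
  ContinuousMultilinearMap.ext fun v => iteratedFDeriv_polynomial (Finset.mem_range.mpr hn) _
    (fun j σ v => iteratedFDeriv_perm f.contDiff j 0 σ v) v

end VectorField

@[simp]
theorem factorEval_tmul {d j : ℕ} (f : VectorField d) (ξ : Module.Dual ℝ (Space d))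
    (v : Fin j → Space d) :
    factorEval f j (ξ ⊗ₜ SymmetricPower.tprod ℝ v) = ξ (iteratedFDeriv ℝ j f 0 v) := by
  simp [factorEval, taylorCoeff]

theorem span_tmul_tprod_eq_top (d j : ℕ) :
    Submodule.span ℝ (Set.image2 (fun (ξ : Module.Dual ℝ (Space d)) (s : Sym[ℝ]^j (Space d)) =>
      ξ ⊗ₜ[ℝ] s) Set.univ (Set.range (SymmetricPower.tprod ℝ))) =
      (⊤ : Submodule ℝ (Factor d j)) := by
  refine (Submodule.map₂_span_span ℝ (TensorProduct.mk ℝ _ _) _ _).symm.trans ?_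
  rw [Submodule.span_univ, SymmetricPower.span_tprod_eq_top,
    TensorProduct.map₂_mk_top_top_eq_top]

theorem factor_hom_ext {d j : ℕ} {W : Type*} [AddCommMonoid W] [Module ℝ W]
    {p q : Factor d j →ₗ[ℝ] W}
    (h : ∀ ξ v, p (ξ ⊗ₜ SymmetricPower.tprod ℝ v) = q (ξ ⊗ₜ SymmetricPower.tprod ℝ v)) : p = q :=
  LinearMap.ext_on (span_tmul_tprod_eq_top d j) (by rintro _ ⟨ξ, -, _, ⟨v, rfl⟩, rfl⟩; exact h ξ v)

/-- The multilinear map `M ^ j → M` which corresponds to a linear form on `M* ⊗ sym^j M`; applied to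
the contraction with a `j`-th derivative, it gives back that derivative. -/
def multilinearOfDual (d j : ℕ) : Module.Dual ℝ (Factor d j) →ₗ[ℝ]
    MultilinearMap ℝ (fun _ : Fin j => Space d) (Space d) where
  toFun l := ((Module.evalEquiv ℝ (Space d)).symm.toLinearMap ∘ₗ
    (TensorProduct.lcurry (.id ℝ) _ _ _ l).flip).compMultilinearMap (SymmetricPower.tprod ℝ)
  map_add' l l' := MultilinearMap.ext fun v =>
    Module.eval_apply_injective ℝ (LinearMap.ext fun ξ => by simp)
  map_smul' c l := MultilinearMap.ext fun v =>
    Module.eval_apply_injective ℝ (LinearMap.ext fun ξ => by simp)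

theorem multilinearOfDual_perm {d j : ℕ} (l : Module.Dual ℝ (Factor d j))
    (σ : Equiv.Perm (Fin j)) (v : Fin j → Space d) :
    multilinearOfDual d j l (fun i => v (σ i)) = multilinearOfDual d j l v := by
  simp [multilinearOfDual]

theorem apply_multilinearOfDual {d j : ℕ} (l : Module.Dual ℝ (Factor d j))
    (ξ : Module.Dual ℝ (Space d)) (v : Fin j → Space d) :
    ξ (multilinearOfDual d j l v) = l (ξ ⊗ₜ SymmetricPower.tprod ℝ v) := by
  simp [multilinearOfDual]

theorem multilinearOfDual_factorEval {d j : ℕ} (f : VectorField d) :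
    multilinearOfDual d j (factorEval f j) = (iteratedFDeriv ℝ j f 0).toMultilinearMap := by
  ext1 v
  refine Module.eval_apply_injective ℝ (LinearMap.ext fun ξ => ?_)
  exact (apply_multilinearOfDual _ ξ v).trans (factorEval_tmul f ξ v)

theorem exists_factorEval_eq {d : ℕ} (s : Finset ℕ) (l : ∀ j, Factor d j →ₗ[ℝ] ℝ) :
    ∃ f : VectorField d, ∀ j ∈ s, factorEval f j = l j := by
  refine ⟨VectorField.polynomial s fun j => multilinearOfDual d j (l j),
    fun j hj => factor_hom_ext fun ξ v => ?_⟩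
  rw [factorEval_tmul, VectorField.iteratedFDeriv_polynomial hj _
    fun j => multilinearOfDual_perm (l j), apply_multilinearOfDual]

theorem VectorField.exists_taylor_eq_sum (d m : ℕ) :
    ∃ (I : Type) (_ : Fintype I) (j : I → ℕ) (S : ∀ a, Factor d (j a)) (p : I → VectorField d),
      ∀ f : VectorField d, f.taylor m = ∑ a, factorEval f (j a) (S a) • p a := by
  let b (j : ℕ) := Module.finBasis ℝ (Factor d j)
  refine ⟨(j : Fin m) × Fin (Module.finrank ℝ (Factor d j)), inferInstance, fun a => a.1,
    fun a => b a.1 a.2, fun a => ((a.1 : ℕ).factorial : ℝ)⁻¹ •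
      homogeneous (multilinearOfDual d a.1 ((b a.1).coord a.2)), fun f => ?_⟩
  rw [taylor, polynomial, Finset.sum_range, Fintype.sum_sigma]
  refine Finset.sum_congr rfl fun j _ => ?_
  rw [← multilinearOfDual_factorEval, ← (b j).sum_dual_apply_smul_coord (factorEval f j)]
  simp only [map_sum, map_smul, Finset.smul_sum]
  exact Finset.sum_congr rfl fun i _ => smul_comm _ _ _

/-! ### Dilations of flat vector fields -/

theorem exists_norm_iteratedFDeriv_le_of_flat {E F : Type*} [NormedAddCommGroup E]
    [NormedSpace ℝ E] [ProperSpace E] [NormedAddCommGroup F] [NormedSpace ℝ F] {f : E → F}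
    (hf : ContDiff ℝ ∞ f) {N : ℕ} (hN : ∀ n < N, iteratedFDeriv ℝ n f 0 = 0) (R : ℝ) (n : ℕ) :
    ∃ C : ℝ, 0 ≤ C ∧ ∀ x, ‖x‖ ≤ R → ‖iteratedFDeriv ℝ n f x‖ ≤ C * ‖x‖ ^ (N - n) := by
  induction hk : N - n generalizing n with
  | zero =>
    have hcont : Continuous (iteratedFDeriv ℝ n f) :=
      hf.continuous_iteratedFDeriv (by exact_mod_cast le_top)
    obtain ⟨C, hC⟩ :=
      (isCompact_closedBall (0 : E) R).exists_bound_of_continuousOn hcont.continuousOn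
    refine ⟨max C 0, le_max_right _ _, fun x hx => ?_⟩
    rw [pow_zero, mul_one]
    exact (hC x (by simpa using hx)).trans (le_max_left _ _)
  | succ k ih =>
    obtain ⟨C, hC0, hC⟩ := ih (n + 1) (by omega)
    refine ⟨C, hC0, fun x hx => ?_⟩
    have hdiff : Differentiable ℝ (iteratedFDeriv ℝ n f) :=
      hf.differentiable_iteratedFDeriv (by exact_mod_cast WithTop.coe_lt_top _)
    have hbound (y : E) (hy : y ∈ Metric.closedBall 0 ‖x‖) :
        ‖fderiv ℝ (iteratedFDeriv ℝ n f) y‖ ≤ C * ‖x‖ ^ k := by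
      have hyx : ‖y‖ ≤ ‖x‖ := by simpa using hy
      rw [norm_fderiv_iteratedFDeriv]
      exact (hC y (hyx.trans hx)).trans (by gcongr)
    have := (convex_closedBall (0 : E) ‖x‖).norm_image_sub_le_of_norm_fderiv_le
      (fun y _ => hdiff y) hbound (x := 0) (y := x) (by simp) (by simp)
    rwa [hN n (by omega), sub_zero, sub_zero, mul_assoc, ← pow_succ] at this

namespace VectorField

variable {d : ℕ} {Y : Type*}

theorem continuous_of_continuous_iteratedFDeriv [TopologicalSpace Y] {F : Y → VectorField d}
    (h : ∀ n : ℕ, Continuous fun p : Y × Space d => iteratedFDeriv ℝ n (F p.1) p.2) :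
    Continuous F :=
  continuous_iInf_rng.mpr fun n => continuous_induced_rng.mpr
    (ContinuousMap.continuous_of_continuous_uncurry _ (h n))

theorem tendsto_zero_of_norm_iteratedFDeriv_le {l : Filter Y} {F : Y → VectorField d}
    (h : ∀ (n : ℕ) (R : ℝ), ∃ b : Y → ℝ, Tendsto b l (𝓝 0) ∧
      ∀ᶠ y in l, ∀ x, ‖x‖ ≤ R → ‖iteratedFDeriv ℝ n (F y) x‖ ≤ b y) :
    Tendsto F l (𝓝 0) := by
  rw [nhds_iInf, tendsto_iInf]
  intro n
  rw [nhds_induced, tendsto_comap_iff, map_zero,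
    ContinuousMap.tendsto_iff_forall_isCompact_tendstoUniformlyOn]
  intro K hK
  obtain ⟨R, hR⟩ := hK.exists_bound_of_continuousOn (f := id) continuousOn_id
  obtain ⟨b, hb, hF⟩ := h n R
  refine Metric.tendstoUniformlyOn_iff.mpr fun ε hε => ?_
  filter_upwards [hF, hb.eventually (gt_mem_nhds hε)] with y hy hyε x hx
  rw [ContinuousMap.coe_zero, Pi.zero_apply, dist_zero_left]
  exact (hy x (hR x hx)).trans_lt hyε

theorem continuous_iteratedFDeriv (n : ℕ) :
    Continuous fun p : VectorField d × Space d => iteratedFDeriv ℝ n p.1 p.2 := by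
  have hn : Continuous (iteratedDerivative (d := d) n) :=
    continuous_iInf_dom (i := n) continuous_induced_dom
  exact continuous_eval.comp ((hn.comp continuous_fst).prodMk continuous_snd)

theorem continuous_eval (x : Space d) : Continuous (eval x) := by
  have h : Continuous fun f : VectorField d => iteratedFDeriv ℝ 0 f x fun _ => 0 :=
    (continuous_eval_const (F := ContinuousMultilinearMap ℝ (fun _ : Fin 0 => Space d) (Space d))
      (fun _ => (0 : Space d))).comp
      ((continuous_iteratedFDeriv 0).comp (continuous_id.prodMk continuous_const))
  exact h.congr fun f => iteratedFDeriv_zero_apply _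

theorem continuous_dilate (f : VectorField d) : Continuous fun t : ℝ => f.dilate t := by
  refine continuous_of_continuous_iteratedFDeriv fun n => ?_
  simp only [iteratedFDeriv_dilate]
  have hf : Continuous (iteratedFDeriv ℝ n f) :=
    f.contDiff.continuous_iteratedFDeriv (by exact_mod_cast le_top)
  fun_prop

theorem tendsto_dilate_of_flat {N : ℕ} {f : VectorField d}
    (hf : ∀ n < N + 1, iteratedFDeriv ℝ n f 0 = 0) :
    Tendsto (fun t : ℝ => (t ^ N)⁻¹ • f.dilate t) (𝓝[≠] 0) (𝓝 0) := by
  refine tendsto_zero_of_norm_iteratedFDeriv_le fun n R => ?_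
  obtain ⟨C, hC0, hC⟩ := exists_norm_iteratedFDeriv_le_of_flat f.contDiff hf R n
  refine ⟨fun t => C * R ^ (N + 1 - n) * |t|, ?_, ?_⟩
  · have : Continuous fun t : ℝ => C * R ^ (N + 1 - n) * |t| := by fun_prop
    simpa using (this.tendsto 0).mono_left nhdsWithin_le_nhds
  filter_upwards [self_mem_nhdsWithin,
    nhdsWithin_le_nhds (Metric.closedBall_mem_nhds (0 : ℝ) one_pos)] with t ht0 ht1 x hx
  replace ht0 : 0 < |t| := abs_pos.mpr ht0
  replace ht1 : |t| ≤ 1 := by simpa using ht1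
  have htx : ‖t • x‖ = |t| * ‖x‖ := norm_smul t x
  have htxR : ‖t • x‖ ≤ R := htx.trans_le ((mul_le_of_le_one_left (norm_nonneg x) ht1).trans hx)
  have deriv_eq : iteratedFDeriv ℝ n ((t ^ N)⁻¹ • f.dilate t : VectorField d) x =
      (t ^ N)⁻¹ • t ^ n • iteratedFDeriv ℝ n f (t • x) := by
    rw [← derivativeAt_apply, map_smul, derivativeAt_apply, iteratedFDeriv_dilate]
  have hR0 : 0 ≤ R := (norm_nonneg x).trans hx
  have pow_le : |t| ^ (n + (N + 1 - n)) ≤ |t| ^ (N + 1) :=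
    pow_le_pow_of_le_one ht0.le ht1 (by omega)
  calc ‖iteratedFDeriv ℝ n ((t ^ N)⁻¹ • f.dilate t : VectorField d) x‖
      = (|t| ^ N)⁻¹ * (|t| ^ n * ‖iteratedFDeriv ℝ n f (t • x)‖) := by
        rw [deriv_eq, norm_smul, norm_smul, norm_inv, norm_pow, norm_pow, Real.norm_eq_abs]
    _ ≤ (|t| ^ N)⁻¹ * (|t| ^ n * (C * (|t| * ‖x‖) ^ (N + 1 - n))) := by
        gcongr
        exact htx ▸ hC _ htxR
    _ = (|t| ^ N)⁻¹ * (C * ‖x‖ ^ (N + 1 - n)) * |t| ^ (n + (N + 1 - n)) := by ring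
    _ ≤ (|t| ^ N)⁻¹ * (C * R ^ (N + 1 - n)) * |t| ^ (N + 1) := by gcongr
    _ = C * R ^ (N + 1 - n) * |t| := by
        rw [pow_succ]
        field_simp

/-- The vector field `x ↦ f (x + b)`. -/
def translate (b : Space d) (f : VectorField d) : VectorField d :=
  ⟨fun x => f (x + b), f.contDiff.comp (contDiff_id.add contDiff_const)⟩

theorem translate_eq_affineAct (b : Space d) (f : VectorField d) :
    f.translate b = f.affineAct (AffineEquiv.constVAdd ℝ (Space d) (-b)) := by
  refine Subtype.ext (funext fun x => ?_)
  change f (x + b) = f (-(-b) + x)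
  rw [neg_neg, add_comm]

theorem iteratedFDeriv_translate (b : Space d) (f : VectorField d) (n : ℕ) (x : Space d) :
    iteratedFDeriv ℝ n (f.translate b) x = iteratedFDeriv ℝ n f (x + b) :=
  iteratedFDeriv_comp_add_right n b x

theorem affineAct_smulOfUnit_dilate (c : ℝˣ) (f : VectorField d) :
    (f.dilate c).affineAct (LinearEquiv.smulOfUnit c : Space d ≃ₗ[ℝ] Space d).toAffineEquiv =
      (c : ℝ) • f :=
  Subtype.ext (funext fun x => congrArg (fun y => (c : ℝ) • f y) (smul_inv_smul c x))

end VectorField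

/-! ### Equivariant maps depend on finite jets -/

theorem exists_tendsto_zero_smulOfUnit_mem {d : ℕ} {H : Subgroup (Space d ≃ₗ[ℝ] Space d)} {c : ℝˣ}
    (hc : |(c : ℝ)| ≠ 1) (hcH : LinearEquiv.smulOfUnit c ∈ H) :
    ∃ u : ℕ → ℝˣ, (∀ k, LinearEquiv.smulOfUnit (u k) ∈ H) ∧
      Tendsto (fun k => (u k : ℝ)) atTop (𝓝[≠] 0) := by
  wlog hlt : |(c : ℝ)| < 1 generalizing c
  · refine this (c := c⁻¹) ?_ (inv_mem hcH) ?_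
    · simpa [abs_inv] using hc
    · rw [Units.val_inv_eq_inv_val, abs_inv]
      exact inv_lt_one_of_one_lt₀ (lt_of_le_of_ne (not_lt.mp hlt) hc.symm)
  refine ⟨fun k => c ^ k, fun k => ?_, tendsto_nhdsWithin_iff.mpr ⟨?_, .of_forall fun k => ?_⟩⟩
  · have hpow : (LinearEquiv.smulOfUnit (c ^ k) : Space d ≃ₗ[ℝ] Space d) =
        LinearEquiv.smulOfUnit c ^ k := map_pow (DistribMulAction.toModuleAut ℝ (Space d)) c k
    exact hpow ▸ pow_mem hcH k
  · simpa using tendsto_pow_atTop_nhds_zero_of_abs_lt_one hlt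
  · exact (c ^ k).ne_zero

/-- Equivariance under `H ⋉ ℝ^d` of a map in `m` vector fields. -/
def IsEquivariant {d m : ℕ} (H : Subgroup (Space d ≃ₗ[ℝ] Space d))
    (φ : (Fin m → VectorField d) → VectorField d) : Prop :=
  ∀ g ∈ affineGroup H, ∀ f : Fin m → VectorField d,
    φ (fun i => (f i).affineAct g) = (φ f).affineAct g

namespace IsEquivariant

section

variable {d m : ℕ} {H : Subgroup (Space d ≃ₗ[ℝ] Space d)}

theorem apply_eq {φ : (Fin m → VectorField d) → VectorField d} (hφ : IsEquivariant H φ)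
    (f : Fin m → VectorField d) (b : Space d) : φ f b = φ (fun i => (f i).translate b) 0 := by
  simp only [VectorField.translate_eq_affineAct]
  rw [hφ (AffineEquiv.constVAdd ℝ (Space d) (-b)) H.one_mem, ← VectorField.translate_eq_affineAct]
  exact congrArg (φ f) (zero_add b).symm

theorem smul_apply_dilate
    {φ : MultilinearMap ℝ (fun _ : Fin m => VectorField d) (VectorField d)}
    (hφ : IsEquivariant H φ) {c : ℝˣ} (hc : LinearEquiv.smulOfUnit c ∈ H)
    (f : Fin m → VectorField d) :
    (c : ℝ) • φ (fun i => (f i).dilate c) 0 = (c : ℝ) ^ m • φ f 0 := by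
  have h := hφ (LinearEquiv.smulOfUnit c).toAffineEquiv hc fun i => (f i).dilate c
  simp only [VectorField.affineAct_smulOfUnit_dilate] at h
  rw [φ.map_smul_univ (fun _ => (c : ℝ)), Finset.prod_const, Finset.card_univ,
    Fintype.card_fin] at h
  refine (congrArg (fun y => (c : ℝ) • φ (fun i => (f i).dilate c) y)
    (smul_zero c⁻¹)).symm.trans (congrArg (VectorField.eval 0) h.symm)

theorem apply_update_dilate {N : ℕ}
    {φ : MultilinearMap ℝ (fun _ : Fin (N + 1) => VectorField d) (VectorField d)}
    (hφ : IsEquivariant H φ) {c : ℝˣ} (hc : LinearEquiv.smulOfUnit c ∈ H)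
    (f : Fin (N + 1) → VectorField d) (i : Fin (N + 1)) :
    φ (Function.update (fun k => (f k).dilate c) i (((c : ℝ) ^ N)⁻¹ • (f i).dilate c)) 0 =
      φ f 0 := by
  have h := smul_apply_dilate hφ hc f
  rw [pow_succ', mul_smul] at h
  rw [φ.map_update_smul, Function.update_eq_self i fun k => (f k).dilate c]
  exact (inv_smul_eq_iff₀ (pow_ne_zero N c.ne_zero)).mpr (smul_right_injective _ c.ne_zero h)

theorem apply_zero_eq_zero {c : ℝˣ} (hc : |(c : ℝ)| ≠ 1) (hcH : LinearEquiv.smulOfUnit c ∈ H)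
    {φ : MultilinearMap ℝ (fun _ : Fin 0 => VectorField d) (VectorField d)}
    (hφ : IsEquivariant H φ) (f : Fin 0 → VectorField d) : φ f 0 = 0 := by
  have h := smul_apply_dilate hφ hcH f
  rw [Subsingleton.elim (fun i => (f i).dilate c) f, pow_zero, ← sub_eq_zero, ← sub_smul] at h
  refine (smul_eq_zero.mp h).resolve_left fun hc1 => hc ?_
  rw [sub_eq_zero.mp hc1, abs_one]

end

section

variable {d m : ℕ} {H : Subgroup (Space d ≃ₗ[ℝ] Space d)} {c : ℝˣ} (hc : |(c : ℝ)| ≠ 1)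
  (hcH : LinearEquiv.smulOfUnit c ∈ H)
  {φ : ContinuousMultilinearMap ℝ (fun _ : Fin m => VectorField d) (VectorField d)}
  (hφ : IsEquivariant H φ)

include hc hcH hφ

theorem apply_eq_zero_of_flat (f : Fin m → VectorField d) (i : Fin m)
    (hf : ∀ n < m, iteratedFDeriv ℝ n (f i) 0 = 0) : φ f 0 = 0 := by
  obtain ⟨N, rfl⟩ : ∃ N, m = N + 1 := ⟨m - 1, by have := i.2; omega⟩
  obtain ⟨u, hu, hlim⟩ := exists_tendsto_zero_smulOfUnit_mem hc hcH
  let F (t : ℝ) : Fin (N + 1) → VectorField d :=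
    Function.update (fun k => (f k).dilate t) i ((t ^ N)⁻¹ • (f i).dilate t)
  let F₀ : Fin (N + 1) → VectorField d := Function.update (fun k => (f k).dilate 0) i 0
  have F_lim : Tendsto F (𝓝[≠] 0) (𝓝 F₀) := by
    refine Tendsto.update (tendsto_pi_nhds.mpr fun k => ?_) i
      (VectorField.tendsto_dilate_of_flat hf)
    exact ((f k).continuous_dilate.tendsto 0).mono_left nhdsWithin_le_nhds
  have F₀_zero : φ F₀ 0 = 0 :=
    congrArg (VectorField.eval 0) (φ.toMultilinearMap.map_update_zero _ i)
  have eval_cont : Continuous fun g => φ g 0 := (VectorField.continuous_eval 0).comp φ.cont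
  have apply_lim : Tendsto (fun k => φ (F (u k)) 0) atTop (𝓝 (φ F₀ 0)) :=
    (eval_cont.tendsto F₀).comp (F_lim.comp hlim)
  refine Eq.trans (tendsto_nhds_unique tendsto_const_nhds (apply_lim.congr fun k => ?_)) F₀_zero
  exact apply_update_dilate (φ := φ.toMultilinearMap) hφ (hu k) f i

theorem apply_taylor (f : Fin m → VectorField d) : φ (fun i => (f i).taylor m) 0 = φ f 0 := by
  classical
  let r (i : Fin m) : VectorField d := f i - (f i).taylor m
  have r_flat (i : Fin m) (n : ℕ) (hn : n < m) : iteratedFDeriv ℝ n (r i) 0 = 0 := by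
    rw [← VectorField.derivativeAt_apply, map_sub, VectorField.derivativeAt_apply,
      VectorField.derivativeAt_apply, VectorField.iteratedFDeriv_taylor hn, sub_self]
  have f_eq : f = r + fun i => (f i).taylor m := by
    ext1 i
    exact (sub_add_cancel _ _).symm
  conv_rhs => rw [← VectorField.eval_apply, f_eq, φ.map_add_univ, map_sum]
  rw [Finset.sum_eq_single ∅, Finset.piecewise_empty, VectorField.eval_apply]
  · intro s _ hs
    obtain ⟨i, hi⟩ := Finset.nonempty_iff_ne_empty.mpr hs
    refine apply_eq_zero_of_flat hc hcH hφ _ i fun n hn => ?_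
    rw [Finset.piecewise_eq_of_mem _ _ _ hi, r_flat i n hn]
  · exact fun h => absurd (Finset.mem_univ _) h

theorem tsupport_subset (f : Fin m → VectorField d) :
    tsupport (φ f) ⊆ tsupport fun x (i : Fin m) => f i x := by
  refine closure_minimal (fun x hx => not_imp_comm.mp (fun hxf => ?_) hx) (isClosed_tsupport _)
  rw [hφ.apply_eq]
  rcases Nat.eq_zero_or_pos m with rfl | hm
  · exact apply_zero_eq_zero hc hcH hφ _
  · refine apply_eq_zero_of_flat hc hcH hφ _ ⟨0, hm⟩ fun n _ => ?_
    have hxf₀ : x ∉ tsupport (f ⟨0, hm⟩) := fun h => hxf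
      (closure_mono (fun y hy => Function.ne_iff.mpr ⟨⟨0, hm⟩, hy⟩) h)
    rw [VectorField.iteratedFDeriv_translate, zero_add]
    exact image_eq_zero_of_notMem_tsupport fun h => hxf₀ (tsupport_iteratedFDeriv_subset n h)

end

end IsEquivariant

/-- The continuous symmetric `m`-linear maps on vector fields that are equivariant under
`H ⋉ ℝ^d`. -/
def equivariantMaps {d : ℕ} (H : Subgroup (Space d ≃ₗ[ℝ] Space d)) (m : ℕ) :
    Submodule ℝ (ContinuousMultilinearMap ℝ (fun _ : Fin m => VectorField d) (VectorField d)) where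
  carrier := {φ |
    (∀ (σ : Equiv.Perm (Fin m)) (f : Fin m → VectorField d), φ (fun i => f (σ i)) = φ f) ∧
    IsEquivariant H φ}
  add_mem' hφ hψ := ⟨fun σ f => congrArg₂ (· + ·) (hφ.1 σ f) (hψ.1 σ f), fun g hg f =>
    Subtype.ext (funext fun x => (congrArg₂ (fun a b : VectorField d => a x + b x)
      (hφ.2 g hg f) (hψ.2 g hg f)).trans (map_add g.linear _ _).symm)⟩
  zero_mem' := ⟨fun _ _ => rfl, fun g _ _ =>
    Subtype.ext (funext fun _ => (map_zero g.linear).symm)⟩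
  smul_mem' c _ hφ := ⟨fun σ f => congrArg (c • ·) (hφ.1 σ f), fun g hg f =>
    Subtype.ext (funext fun x => (congrArg (fun a : VectorField d => c • a x)
      (hφ.2 g hg f)).trans (map_smul g.linear c _).symm)⟩

theorem localEquivariantMaps_eq_equivariantMaps {d m : ℕ} {H : Subgroup (Space d ≃ₗ[ℝ] Space d)}
    {c : ℝˣ} (hc : |(c : ℝ)| ≠ 1) (hcH : LinearEquiv.smulOfUnit c ∈ H) :
    localEquivariantMaps H m = equivariantMaps H m :=
  Submodule.ext fun _ => ⟨fun hφ => ⟨hφ.1, hφ.2.2⟩, fun hφ =>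
    ⟨hφ.1, hφ.2.tsupport_subset hc hcH, hφ.2⟩⟩

/-! ### Smooth families -/

section JointlySmooth

universe u

variable {Y Z : Type*} [TopologicalSpace Y] [TopologicalSpace Z] {E F F₁ F₂ : Type u}
  [NormedAddCommGroup E] [NormedSpace ℝ E] [NormedAddCommGroup F] [NormedSpace ℝ F]
  [NormedAddCommGroup F₁] [NormedSpace ℝ F₁] [NormedAddCommGroup F₂] [NormedSpace ℝ F₂]

/-- A family of smooth functions all of whose derivatives are jointly continuous in the parameter
and the variable. -/
structure JointlySmooth (Φ : Y → E → F) : Prop where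
  contDiff (y : Y) : ContDiff ℝ ∞ (Φ y)
  continuous_iteratedFDeriv (n : ℕ) : Continuous fun p : Y × E => iteratedFDeriv ℝ n (Φ p.1) p.2

namespace JointlySmooth

theorem continuous {Φ : Y → E → F} (h : JointlySmooth Φ) :
    Continuous fun p : Y × E => Φ p.1 p.2 := by
  have := (continuousMultilinearCurryFin0 ℝ E F).continuous.comp (h.continuous_iteratedFDeriv 0)
  simpa [Function.comp_def, iteratedFDeriv_zero_eq_comp] using this

theorem comp_param {Φ : Y → E → F} (h : JointlySmooth Φ) {g : Z → Y} (hg : Continuous g) :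
    JointlySmooth fun z => Φ (g z) :=
  ⟨fun z => h.contDiff (g z),
    fun n => (h.continuous_iteratedFDeriv n).comp (hg.prodMap continuous_id)⟩

theorem fderiv {Φ : Y → E → F} (h : JointlySmooth Φ) : JointlySmooth fun y => fderiv ℝ (Φ y) := by
  refine ⟨fun y => (h.contDiff y).fderiv_right (by simp), fun n => ?_⟩
  have := (continuousMultilinearCurryRightEquiv' ℝ n E F).continuous.comp
    (h.continuous_iteratedFDeriv (n + 1))
  simpa [Function.comp_def, iteratedFDeriv_succ_eq_comp_right] using this

theorem const (c : F) : JointlySmooth fun (_ : Y) (_ : E) => c := by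
  refine ⟨fun _ => contDiff_const, fun n => ?_⟩
  cases n with
  | zero =>
    simp only [iteratedFDeriv_zero_eq_comp, Function.comp_def]
    exact continuous_const
  | succ n => simpa [iteratedFDeriv_const_of_ne (Nat.succ_ne_zero n)] using! continuous_const

theorem add {Φ Ψ : Y → E → F} (h : JointlySmooth Φ) (k : JointlySmooth Ψ) :
    JointlySmooth fun y x => Φ y x + Ψ y x := by
  refine ⟨fun y => (h.contDiff y).add (k.contDiff y), fun n =>
    ((h.continuous_iteratedFDeriv n).add (k.continuous_iteratedFDeriv n)).congr fun p => ?_⟩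
  exact (iteratedFDeriv_add_apply ((h.contDiff p.1).contDiffAt.of_le (by exact_mod_cast le_top))
    ((k.contDiff p.1).contDiffAt.of_le (by exact_mod_cast le_top))).symm

theorem sum {ι : Type*} {Φ : ι → Y → E → F} (s : Finset ι) (h : ∀ i, JointlySmooth (Φ i)) :
    JointlySmooth fun y x => ∑ i ∈ s, Φ i y x := by
  classical
  induction s using Finset.induction_on with
  | empty => simpa using const (0 : F)
  | insert a s ha ih =>
    simp only [Finset.sum_insert ha]
    exact (h a).add ih

theorem clm_comp {Φ : Y → E → F} (h : JointlySmooth Φ) (L : F →L[ℝ] F₁) :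
    JointlySmooth fun y x => L (Φ y x) := by
  refine ⟨fun y => L.contDiff.comp (h.contDiff y), fun n => ?_⟩
  refine ((ContinuousLinearMap.compContinuousMultilinearMapL ℝ (fun _ : Fin n => E) F F₁ L
    ).continuous.comp (h.continuous_iteratedFDeriv n)).congr fun p => ?_
  exact (L.iteratedFDeriv_comp_left (h.contDiff p.1).contDiffAt
    (by exact_mod_cast le_top)).symm

theorem clm_apply₂ (B : F₁ →L[ℝ] F₂ →L[ℝ] F) {Φ : Y → E → F₁} {Ψ : Y → E → F₂}
    (h : JointlySmooth Φ) (k : JointlySmooth Ψ) : JointlySmooth fun y x => B (Φ y x) (Ψ y x) := by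
  refine ⟨fun y => (B.contDiff.comp (h.contDiff y)).clm_apply (k.contDiff y), fun n => ?_⟩
  induction n generalizing F₁ F₂ F with
  | zero =>
    simp only [iteratedFDeriv_zero_eq_comp]
    exact (continuousMultilinearCurryFin0 ℝ E F).symm.continuous.comp
      (B.isBoundedBilinearMap.continuous.comp (h.continuous.prodMk k.continuous))
  | succ n ih =>
    have leibniz (y : Y) : (fun x => _root_.fderiv ℝ (fun x => B (Φ y x) (Ψ y x)) x) = fun x =>
        B.precompR E (Φ y x) (_root_.fderiv ℝ (Ψ y) x) +
          B.precompL E (_root_.fderiv ℝ (Φ y) x) (Ψ y x) :=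
      funext fun x => B.fderiv_of_bilinear ((h.contDiff y).differentiable (by simp) x)
        ((k.contDiff y).differentiable (by simp) x)
    have smooth₁ (y : Y) : ContDiff ℝ ∞ fun x => B.precompR E (Φ y x) (_root_.fderiv ℝ (Ψ y) x) :=
      (B.precompR E).isBoundedBilinearMap.contDiff.comp
        ((h.contDiff y).prodMk (k.fderiv.contDiff y))
    have smooth₂ (y : Y) : ContDiff ℝ ∞ fun x => B.precompL E (_root_.fderiv ℝ (Φ y) x) (Ψ y x) :=
      (B.precompL E).isBoundedBilinearMap.contDiff.comp
        ((h.fderiv.contDiff y).prodMk (k.contDiff y))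
    simp only [iteratedFDeriv_succ_eq_comp_right, leibniz]
    refine (continuousMultilinearCurryRightEquiv' ℝ n E F).symm.continuous.comp ?_
    refine ((ih (B.precompR E) h k.fderiv).add (ih (B.precompL E) h.fderiv k)).congr fun p => ?_
    exact (iteratedFDeriv_add_apply ((smooth₁ p.1).contDiffAt.of_le (by exact_mod_cast le_top))
      ((smooth₂ p.1).contDiffAt.of_le (by exact_mod_cast le_top))).symm

theorem prod {E : Type} [NormedAddCommGroup E] [NormedSpace ℝ E] {ι : Type*} {Φ : ι → Y → E → ℝ}
    (s : Finset ι) (h : ∀ i, JointlySmooth (Φ i)) :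
    JointlySmooth fun y x => ∏ i ∈ s, Φ i y x := by
  classical
  induction s using Finset.induction_on with
  | empty => simpa using const (1 : ℝ)
  | insert a s ha ih =>
    simp only [Finset.prod_insert ha]
    exact clm_apply₂ (ContinuousLinearMap.mul ℝ ℝ) (h a) ih

end JointlySmooth

end JointlySmooth

theorem VectorField.jointlySmooth_iteratedFDeriv {d : ℕ} (j : ℕ) :
    JointlySmooth fun f : VectorField d => iteratedFDeriv ℝ j f := by
  induction j with
  | zero =>
    have h : JointlySmooth fun f : VectorField d => (f : Space d → Space d) :=
      ⟨fun f => f.contDiff, continuous_iteratedFDeriv⟩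
    exact h.clm_comp (continuousMultilinearCurryFin0 ℝ (Space d)
      (Space d)).symm.toContinuousLinearEquiv.toContinuousLinearMap
  | succ j ih =>
    have h := ih.fderiv.clm_comp (continuousMultilinearCurryLeftEquiv ℝ
      (fun _ : Fin (j + 1) => Space d)
      (Space d)).symm.toContinuousLinearEquiv.toContinuousLinearMap
    simpa only [iteratedFDeriv_succ_eq_comp_left] using! h

/-! ### Local forms -/

/-- The space of the functions `f ↦ ⟨S, f⟩` with `S ∈ M* ⊗ sym^j M`. -/
def jetForms (d j : ℕ) : Submodule ℝ (VectorField d → ℝ) :=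
  LinearMap.range (LinearMap.pi fun f => factorEval f j)

/-- The function `f ↦ ⟨S, f⟩`, depending linearly on `S ∈ Sym_κ`. -/
def pairing (d : ℕ) (κ : NatComposition) : SymSpace d κ →ₗ[ℝ] VectorField d → Space d :=
  LinearMap.pi fun f => symSpaceEval f κ

/-- The linear forms on vector fields whose values on the translates of a vector field form a smooth
family. -/
def localForms (d : ℕ) : Submodule ℝ (VectorField d → ℝ) where
  carrier := {l | IsLinearMap ℝ l ∧ JointlySmooth fun (f : VectorField d) x => l (f.translate x)}
  add_mem' {l k} hl hk :=
    ⟨(IsLinearMap.mk' l hl.1 + IsLinearMap.mk' k hk.1).isLinear, hl.2.add hk.2⟩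
  zero_mem' := ⟨(0 : VectorField d →ₗ[ℝ] ℝ).isLinear, .const 0⟩
  smul_mem' c l hl := ⟨(c • IsLinearMap.mk' l hl.1).isLinear,
    hl.2.clm_comp (c • ContinuousLinearMap.id ℝ ℝ)⟩

/-- The diagonals of the `m`-linear maps whose values on the translates of `m` vector fields form a
smooth family. -/
def localDiagonals (d m : ℕ) (W : Type) [NormedAddCommGroup W] [NormedSpace ℝ W] :
    Submodule ℝ (VectorField d → W) where
  carrier := {P | ∃ B : MultilinearMap ℝ (fun _ : Fin m => VectorField d) W,
    (∀ f, B (fun _ => f) = P f) ∧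
      JointlySmooth fun (f : Fin m → VectorField d) x => B fun i => (f i).translate x}
  add_mem' := by
    rintro P Q ⟨B, hB, hB'⟩ ⟨C, hC, hC'⟩
    exact ⟨B + C, fun f => by simp [hB, hC], hB'.add hC'⟩
  zero_mem' := ⟨0, fun _ => rfl, .const 0⟩
  smul_mem' := by
    rintro c P ⟨B, hB, hB'⟩
    exact ⟨c • B, fun f => by simp [hB], hB'.clm_comp (c • ContinuousLinearMap.id ℝ W)⟩

theorem jetForms_le_localForms (d j : ℕ) : jetForms d j ≤ localForms d := by
  rw [jetForms, LinearMap.range_eq_map, ← span_tmul_tprod_eq_top, Submodule.map_span_le]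
  rintro _ ⟨ξ, -, _, ⟨v, rfl⟩, rfl⟩
  have apply_eq : LinearMap.pi (fun f => factorEval f j) (ξ ⊗ₜ SymmetricPower.tprod ℝ v) =
      fun f : VectorField d => ξ (iteratedFDeriv ℝ j f 0 v) :=
    funext fun f => factorEval_tmul f ξ v
  refine ⟨?_, ?_⟩
  · let L : VectorField d →ₗ[ℝ] ℝ := ξ ∘ₗ
      (ContinuousMultilinearMap.apply ℝ (fun _ : Fin j => Space d) (Space d) v).toLinearMap ∘ₗ
        VectorField.derivativeAt j 0
    exact apply_eq ▸ L.isLinear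
  · simp only [apply_eq, VectorField.iteratedFDeriv_translate, zero_add]
    exact (VectorField.jointlySmooth_iteratedFDeriv j).clm_comp
      (LinearMap.toContinuousLinearMap ξ ∘L
        ContinuousMultilinearMap.apply ℝ (fun _ : Fin j => Space d) (Space d) v)

theorem localForms_pow_le_localDiagonals (d m : ℕ) : localForms d ^ m ≤ localDiagonals d m ℝ := by
  rw [Submodule.pow_eq_span_pow_set, Submodule.span_le]
  intro a ha
  obtain ⟨l, rfl⟩ := Set.mem_pow.mp ha
  refine ⟨(MultilinearMap.mkPiAlgebra ℝ (Fin m) ℝ).compLinearMap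
    fun i => IsLinearMap.mk' (l i).1 (l i).2.1, fun f => ?_, ?_⟩
  · simp [List.prod_ofFn]
  · simp only [MultilinearMap.compLinearMap_apply, MultilinearMap.mkPiAlgebra_apply]
    exact .prod Finset.univ fun i => (l i).2.2.comp_param (continuous_apply i)

theorem NatComposition.size_eq_sum (κ : NatComposition) : κ.size = ∑ j : κ.support, κ j :=
  (Finset.sum_coe_sort κ.support fun j => κ j).symm

theorem prod_jetForms_le_localDiagonals (d : ℕ) (κ : NatComposition) :
    ∏ j : κ.support, jetForms d j ^ κ j ≤ localDiagonals d κ.size ℝ :=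
  calc ∏ j : κ.support, jetForms d j ^ κ j
      ≤ ∏ j : κ.support, localForms d ^ κ j :=
        Finset.prod_le_prod' fun j _ => pow_le_pow_left' (jetForms_le_localForms d j) _
    _ = localForms d ^ κ.size := by rw [Finset.prod_pow_eq_pow_sum, κ.size_eq_sum]
    _ ≤ localDiagonals d κ.size ℝ := localForms_pow_le_localDiagonals d _

theorem range_pairing_le_localDiagonals (d : ℕ) (κ : NatComposition) :
    LinearMap.range (pairing d κ) ≤ localDiagonals d κ.size (Space d) := by
  rw [LinearMap.range_eq_map, ← TensorProduct.span_tmul_eq_top, Submodule.map_span_le]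
  rintro _ ⟨x, s, rfl⟩
  have hs : LinearMap.pi (fun f => prodEval (fun j : κ.support => κ j) fun j => factorEval f j) s ∈
      localDiagonals d κ.size ℝ := by
    refine prod_jetForms_le_localDiagonals d κ ?_
    exact (range_pi_prodEval (fun f (j : κ.support) => factorEval f j) _).le ⟨s, rfl⟩
  obtain ⟨B, hB, hB'⟩ := hs
  refine ⟨(LinearMap.toSpanSingleton ℝ (Space d) x).compMultilinearMap B, fun f => ?_,
    hB'.clm_comp (ContinuousLinearMap.toSpanSingleton ℝ x)⟩
  have apply_eq : pairing d κ (x ⊗ₜ s) f =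
      prodEval (fun j : κ.support => κ j) (fun j => factorEval f j) s • x := contract_tmul _ x s
  rw [apply_eq, LinearMap.compMultilinearMap_apply, hB]
  rfl

theorem exists_symmetric_of_mem_localDiagonals {d m : ℕ} {W : Type} [NormedAddCommGroup W]
    [NormedSpace ℝ W] {P : VectorField d → W} (hP : P ∈ localDiagonals d m W) :
    ∃ B : MultilinearMap ℝ (fun _ : Fin m => VectorField d) W,
      (∀ (σ : Equiv.Perm (Fin m)) (f : Fin m → VectorField d), B (fun i => f (σ i)) = B f) ∧
      (∀ f, B (fun _ => f) = P f) ∧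
      JointlySmooth fun (f : Fin m → VectorField d) x => B fun i => (f i).translate x := by
  obtain ⟨B, hdiag, hsmooth⟩ := hP
  have average_apply (f : Fin m → VectorField d) :
      ((m.factorial : ℝ)⁻¹ • ∑ σ : Equiv.Perm (Fin m), B.domDomCongr σ) f =
        (m.factorial : ℝ)⁻¹ • ∑ σ : Equiv.Perm (Fin m), B fun i => f (σ i) := by
    simp
  refine ⟨(m.factorial : ℝ)⁻¹ • ∑ σ : Equiv.Perm (Fin m), B.domDomCongr σ, fun τ f => ?_,
    fun f => ?_, ?_⟩
  · rw [average_apply, average_apply]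
    exact congrArg _ (Equiv.sum_comp (Equiv.mulLeft τ) fun σ => B fun i => f (σ i))
  · simp only [average_apply, hdiag, Finset.sum_const, Finset.card_univ, Fintype.card_perm,
      Fintype.card_fin]
    rw [← Nat.cast_smul_eq_nsmul ℝ, inv_smul_smul₀ (by exact_mod_cast m.factorial_ne_zero)]
  · simp only [average_apply]
    refine (JointlySmooth.sum Finset.univ fun σ => ?_).clm_comp
      ((m.factorial : ℝ)⁻¹ • ContinuousLinearMap.id ℝ W)
    exact hsmooth.comp_param (g := fun (f : Fin m → VectorField d) i => f (σ i))
      (continuous_pi fun i => continuous_apply (σ i))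

/-! ### Construction of equivariant maps -/

namespace VectorField

variable {d : ℕ}

/-- Translation of vector fields as a linear map. -/
def translateHom (b : Space d) : VectorField d →ₗ[ℝ] VectorField d where
  toFun := translate b
  map_add' _ _ := rfl
  map_smul' _ _ := rfl

/-- The linear action of the linear group on vector fields. -/
def linearActHom (A : Space d ≃ₗ[ℝ] Space d) : VectorField d →ₗ[ℝ] VectorField d where
  toFun f := f.affineAct A.toAffineEquiv
  map_add' _ _ := Subtype.ext (funext fun _ => map_add A _ _)
  map_smul' c _ := Subtype.ext (funext fun _ => map_smul A c _)

theorem translate_affineAct (g : Space d ≃ᵃ[ℝ] Space d) (f : VectorField d) (b : Space d) :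
    (f.affineAct g).translate b =
      (f.translate (g.symm b)).affineAct g.linear.toAffineEquiv := by
  refine Subtype.ext (funext fun y => ?_)
  have h : g.symm (y + b) = g.linear.symm y + g.symm b := g.symm.map_vadd b y
  exact congrArg (fun z => g.linear (f z)) h

theorem translate_zero (f : VectorField d) : f.translate 0 = f :=
  Subtype.ext (funext fun x => congrArg f (add_zero x))

end VectorField

section FieldMap

variable {d m : ℕ} (B : MultilinearMap ℝ (fun _ : Fin m => VectorField d) (Space d))

/-- The map of vector fields whose value at a point `x` is `B` of the vector fields translated
by `x`. -/
def fieldMap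
    (hB : JointlySmooth fun (f : Fin m → VectorField d) x => B fun i => (f i).translate x) :
    ContinuousMultilinearMap ℝ (fun _ : Fin m => VectorField d) (VectorField d) where
  toFun f := ⟨fun x => B fun i => (f i).translate x, hB.contDiff f⟩
  map_update_add' f i g h := Subtype.ext (funext fun x =>
    (B.compLinearMap fun _ => VectorField.translateHom x).map_update_add f i g h)
  map_update_smul' f i c g := Subtype.ext (funext fun x =>
    (B.compLinearMap fun _ => VectorField.translateHom x).map_update_smul f i c g)
  cont := VectorField.continuous_of_continuous_iteratedFDeriv hB.continuous_iteratedFDeriv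

variable {B}

theorem map_affineAct_of_map_const_affineAct
    (hsymm : ∀ (σ : Equiv.Perm (Fin m)) (f : Fin m → VectorField d), B (fun i => f (σ i)) = B f)
    (A : Space d ≃ₗ[ℝ] Space d)
    (hA : ∀ f : VectorField d, B (fun _ => f.affineAct A.toAffineEquiv) = A (B fun _ => f))
    (f : Fin m → VectorField d) :
    B (fun i => (f i).affineAct A.toAffineEquiv) = A (B f) := by
  have : IsAddTorsionFree (Space d) := .of_isTorsionFree ℝ _
  have h : B.compLinearMap (fun _ => VectorField.linearActHom A) -
      A.toLinearMap.compMultilinearMap B = 0 := by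
    refine eq_zero_of_map_const_eq_zero _ (fun σ f => ?_) fun f => sub_eq_zero.mpr (hA f)
    exact congrArg₂ (· - ·) (hsymm σ fun i => (f i).affineAct A.toAffineEquiv)
      (congrArg A (hsymm σ f))
  exact sub_eq_zero.mp (congrArg (fun C => C f) h)

theorem isEquivariant_fieldMap {H : Subgroup (Space d ≃ₗ[ℝ] Space d)}
    (hB : JointlySmooth fun (f : Fin m → VectorField d) x => B fun i => (f i).translate x)
    (hBH : ∀ A ∈ H, ∀ f : Fin m → VectorField d,
      B (fun i => (f i).affineAct A.toAffineEquiv) = A (B f)) :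
    IsEquivariant H (fieldMap B hB) := by
  intro g hg f
  refine Subtype.ext (funext fun x => ?_)
  change B (fun i => ((f i).affineAct g).translate x) =
    g.linear (B fun i => (f i).translate (g.symm x))
  simp only [VectorField.translate_affineAct]
  exact hBH _ hg _

end FieldMap

theorem exists_equivariantMap_of_mem_localDiagonals {d m : ℕ}
    {H : Subgroup (Space d ≃ₗ[ℝ] Space d)}
    {P : VectorField d → Space d} (hP : P ∈ localDiagonals d m (Space d))
    (hPH : ∀ A ∈ H, ∀ f : VectorField d, P (f.affineAct A.toAffineEquiv) = A (P f)) :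
    ∃ φ : equivariantMaps H m, ∀ f, (φ.1 fun _ => f) 0 = P f := by
  obtain ⟨B, hsymm, hdiag, hsmooth⟩ := exists_symmetric_of_mem_localDiagonals hP
  have hBH (A : Space d ≃ₗ[ℝ] Space d) (hA : A ∈ H) (f : Fin m → VectorField d) :
      B (fun i => (f i).affineAct A.toAffineEquiv) = A (B f) :=
    map_affineAct_of_map_const_affineAct hsymm A (fun f => by simp only [hdiag, hPH A hA]) f
  refine ⟨⟨fieldMap B hsmooth, fun σ f => ?_, isEquivariant_fieldMap hsmooth hBH⟩, fun f => ?_⟩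
  · exact Subtype.ext (funext fun x => hsymm σ fun i => (f i).translate x)
  · change B (fun _ => f.translate 0) = P f
    rw [f.translate_zero, hdiag]

/-! ### Independence of the contractions -/

theorem eq_zero_of_sum_prod_pow_smul_eq_zero {K W σ ι : Type*} [Field K] [Infinite K]
    [AddCommGroup W] [Module K W] {c : ι → σ →₀ ℕ} (hc : Function.Injective c) {s : Finset ι}
    {w : ι → W} (h : ∀ t : σ → K, ∑ i ∈ s, ((c i).prod fun j n => t j ^ n) • w i = 0) {i : ι}
    (hi : i ∈ s) : w i = 0 := by
  classical
  refine (Module.forall_dual_apply_eq_zero_iff K (w i)).mp fun ξ => ?_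
  let p : MvPolynomial σ K := ∑ i ∈ s, MvPolynomial.monomial (c i) (ξ (w i))
  have hp : p = 0 := MvPolynomial.funext fun t => by
    simpa [p, MvPolynomial.eval_monomial, mul_comm] using congrArg ξ (h t)
  calc ξ (w i) = p.coeff (c i) := by
        simp only [p, MvPolynomial.coeff_sum, MvPolynomial.coeff_monomial, hc.eq_iff]
        simp [hi]
    _ = 0 := by rw [hp, MvPolynomial.coeff_zero]

theorem sum_prod_pow_smul_contract_eq_zero {d : ℕ} {ι : Type*} {c : ι → NatComposition}
    {s : Finset ι} {S : ∀ i, SymSpace d (c i)}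
    (h : ∀ f : VectorField d, ∑ i ∈ s, symSpaceEval f (c i) (S i) = 0)
    (l : ∀ j, Factor d j →ₗ[ℝ] ℝ) (t : ℕ → ℝ) :
    ∑ i ∈ s, ((c i).prod fun j n => t j ^ n) •
      contract (Space d) (fun j : (c i).support => c i j) (fun j => l j) (S i) = 0 := by
  classical
  obtain ⟨f, hf⟩ := exists_factorEval_eq (s.biUnion fun i => (c i).support) fun j => t j • l j
  rw [← h f]
  refine Finset.sum_congr rfl fun i hi => ?_
  have eval_eq : (fun j : (c i).support => factorEval f j) = fun j : (c i).support => t j • l j :=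
    funext fun j => hf j (Finset.mem_biUnion.mpr ⟨i, hi, j.2⟩)
  rw [symSpaceEval_eq_contract, eval_eq, contract_smul, LinearMap.smul_apply, Finsupp.prod,
    Finset.prod_coe_sort (c i).support fun j => t j ^ c i j]

theorem eq_zero_of_sum_symSpaceEval_eq_zero {d : ℕ} {ι : Type*} {c : ι → NatComposition}
    (hc : Function.Injective c) {s : Finset ι} {S : ∀ i, SymSpace d (c i)}
    (h : ∀ f : VectorField d, ∑ i ∈ s, symSpaceEval f (c i) (S i) = 0) {i : ι} (hi : i ∈ s) :
    S i = 0 := by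
  classical
  refine eq_zero_of_contract_eq_zero fun l => ?_
  obtain ⟨k, rfl⟩ : ∃ k : ∀ j, Factor d j →ₗ[ℝ] ℝ, l = fun j : (c i).support => k j :=
    ⟨fun j => if hj : j ∈ (c i).support then l ⟨j, hj⟩ else 0, funext fun j => by simp [j.2]⟩
  exact eq_zero_of_sum_prod_pow_smul_eq_zero hc (sum_prod_pow_smul_contract_eq_zero h k) hi

theorem eq_zero_of_symSpaceEval_eq_zero {d : ℕ} {κ : NatComposition} {S : SymSpace d κ}
    (h : ∀ f : VectorField d, symSpaceEval f κ S = 0) : S = 0 :=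
  eq_zero_of_sum_symSpaceEval_eq_zero (c := fun _ : Unit => κ) (S := fun _ => S) (s := {()})
    (Function.injective_of_subsingleton _) (by simpa using h) (Finset.mem_singleton_self ())

/-! ### The action of the linear group on contractions -/

theorem VectorField.iteratedFDeriv_affineAct {d : ℕ} (A : Space d ≃ₗ[ℝ] Space d)
    (f : VectorField d) (j : ℕ) (x : Space d) (v : Fin j → Space d) :
    iteratedFDeriv ℝ j (f.affineAct A.toAffineEquiv) x v =
      A (iteratedFDeriv ℝ j f (A.symm x) fun i => A.symm (v i)) := by
  let L : Space d →L[ℝ] Space d := A.toContinuousLinearEquiv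
  let L' : Space d →L[ℝ] Space d := A.symm.toContinuousLinearEquiv
  have left := L.iteratedFDeriv_comp_left (x := x) (i := j)
    (f.contDiff.comp L'.contDiff).contDiffAt (by exact_mod_cast le_top)
  rw [L'.iteratedFDeriv_comp_right f.contDiff x (by exact_mod_cast le_top)] at left
  exact congrArg (fun D => D v) left

theorem factorEval_affineAct {d : ℕ} {H : Subgroup (Space d ≃ₗ[ℝ] Space d)} (A : H)
    (f : VectorField d) (j : ℕ) :
    factorEval (f.affineAct A.1.toAffineEquiv) j ∘ₗ factorRep H j A = factorEval f j := by
  refine factor_hom_ext fun ξ v => ?_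
  have rep_tmul : factorRep H j A (ξ ⊗ₜ SymmetricPower.tprod ℝ v) =
      (ξ ∘ₗ A.1.symm.toLinearMap) ⊗ₜ SymmetricPower.tprod ℝ fun i => A.1 (v i) :=
    congrArg (_ ⊗ₜ ·) (symMap_tprod (stdRep H A) v)
  rw [LinearMap.comp_apply, rep_tmul, factorEval_tmul, factorEval_tmul,
    VectorField.iteratedFDeriv_affineAct]
  simp

theorem symSpaceEval_affineAct {d : ℕ} {H : Subgroup (Space d ≃ₗ[ℝ] Space d)} (A : H)
    (f : VectorField d) (κ : NatComposition) (S : SymSpace d κ) :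
    symSpaceEval (f.affineAct A.1.toAffineEquiv) κ (symSpaceRep H κ A S) =
      A.1 (symSpaceEval f κ S) := by
  have h := contract_map_map (n := fun j : κ.support => κ j) (stdRep H A)
    (fun j => factorRep H j A) (fun j => factorEval (f.affineAct A.1.toAffineEquiv) j) S
  simp only [factorEval_affineAct] at h
  exact h

theorem symSpaceEval_eq_prod_pow_smul {d : ℕ} {f g : VectorField d} {r : ℕ → ℝ}
    (h : ∀ j, factorEval g j = r j • factorEval f j) (κ : NatComposition) (S : SymSpace d κ) :
    symSpaceEval g κ S = (∏ j : κ.support, r j ^ κ j) • symSpaceEval f κ S := by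
  simp only [symSpaceEval_eq_contract, h, contract_smul, LinearMap.smul_apply]

theorem factorEval_smul {d : ℕ} (c : ℝ) (f : VectorField d) (j : ℕ) :
    factorEval (c • f) j = c • factorEval f j := by
  refine factor_hom_ext fun ξ v => ?_
  rw [LinearMap.smul_apply, factorEval_tmul, factorEval_tmul, ← VectorField.derivativeAt_apply,
    map_smul]
  simp [VectorField.derivativeAt_apply]

theorem factorEval_dilate {d : ℕ} (t : ℝ) (f : VectorField d) (j : ℕ) :
    factorEval (f.dilate t) j = t ^ j • factorEval f j :=
  factor_hom_ext fun ξ v => by simp [VectorField.iteratedFDeriv_dilate]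

theorem symSpaceEval_smul {d : ℕ} (c : ℝ) (f : VectorField d) (κ : NatComposition)
    (S : SymSpace d κ) : symSpaceEval (c • f) κ S = c ^ κ.size • symSpaceEval f κ S := by
  rw [symSpaceEval_eq_prod_pow_smul (factorEval_smul c f), Finset.prod_pow_eq_pow_sum,
    κ.size_eq_sum]

theorem NatComposition.derived_size_eq_sum (κ : NatComposition) :
    κ.derived.size = ∑ j : κ.support, j * κ j :=
  (Finsupp.onFinset_sum _ fun _ => rfl).trans
    (Finset.sum_coe_sort κ.support fun j => j * κ j).symm

theorem symSpaceEval_dilate {d : ℕ} (t : ℝ) (f : VectorField d) (κ : NatComposition)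
    (S : SymSpace d κ) :
    symSpaceEval (f.dilate t) κ S = t ^ κ.derived.size • symSpaceEval f κ S := by
  simp only [symSpaceEval_eq_prod_pow_smul (factorEval_dilate t f), ← pow_mul,
    Finset.prod_pow_eq_pow_sum, κ.derived_size_eq_sum]

theorem eq_zero_of_mem_invariants {d : ℕ} {H : Subgroup (Space d ≃ₗ[ℝ] Space d)} {c : ℝˣ}
    (hc : |(c : ℝ)| ≠ 1) (hcH : LinearEquiv.smulOfUnit c ∈ H) {κ : NatComposition}
    {S : SymSpace d κ} (hS : S ∈ (symSpaceRep H κ).invariants)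
    (hκ : κ.derived.size + 1 ≠ κ.size) : S = 0 := by
  refine eq_zero_of_symSpaceEval_eq_zero fun f => ?_
  have scaling : (c : ℝ) ^ κ.size • symSpaceEval f κ S =
      (c : ℝ) ^ (κ.derived.size + 1) • symSpaceEval f κ S :=
    calc (c : ℝ) ^ κ.size • symSpaceEval f κ S
        = symSpaceEval ((f.dilate c).affineAct
            (LinearEquiv.smulOfUnit c : Space d ≃ₗ[ℝ] Space d).toAffineEquiv) κ
              (symSpaceRep H κ ⟨_, hcH⟩ S) := by
          rw [hS, VectorField.affineAct_smulOfUnit_dilate, symSpaceEval_smul]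
      _ = (c : ℝ) • symSpaceEval (f.dilate c) κ S :=
          symSpaceEval_affineAct ⟨_, hcH⟩ (f.dilate c) κ S
      _ = _ := by rw [symSpaceEval_dilate, smul_smul, pow_succ']
  rw [← sub_eq_zero, ← sub_smul] at scaling
  refine (smul_eq_zero.mp scaling).resolve_left fun h => hκ ?_
  refine pow_right_injective₀ (abs_pos.mpr c.ne_zero) hc ?_
  simpa only [abs_pow] using congrArg abs (sub_eq_zero.mp h).symm

theorem VectorField.affineAct_surjective {d : ℕ} (g : Space d ≃ᵃ[ℝ] Space d) :
    Function.Surjective (VectorField.affineAct g) := fun f =>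
  ⟨f.affineAct g.symm, Subtype.ext (funext fun x =>
    (g.linear.apply_symm_apply _).trans (congrArg f (g.apply_symm_apply x)))⟩

theorem mem_invariants_of_sum_symSpaceEval_affineAct {d : ℕ}
    {H : Subgroup (Space d ≃ₗ[ℝ] Space d)} {ι : Type*} {c : ι → NatComposition}
    (hc : Function.Injective c) {s : Finset ι} {S : ∀ i, SymSpace d (c i)}
    (h : ∀ A ∈ H, ∀ f : VectorField d,
      ∑ i ∈ s, symSpaceEval (f.affineAct A.toAffineEquiv) (c i) (S i) =
        A (∑ i ∈ s, symSpaceEval f (c i) (S i))) {i : ι} (hi : i ∈ s) :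
    S i ∈ (symSpaceRep H (c i)).invariants := by
  intro A
  refine sub_eq_zero.mp (eq_zero_of_sum_symSpaceEval_eq_zero hc
    (S := fun i => symSpaceRep H (c i) A (S i) - S i) (fun f => ?_) hi)
  obtain ⟨g, rfl⟩ := VectorField.affineAct_surjective A.1.toAffineEquiv f
  simp only [map_sub, Finset.sum_sub_distrib, symSpaceEval_affineAct, h A.1 A.2, map_sum, sub_self]

/-! ### Equivariant maps as sums of contractions -/

theorem prod_mem_prod_submodule {R A ι : Type*} [CommSemiring R] [CommSemiring A] [Algebra R A]
    (s : Finset ι) {p : ι → Submodule R A} {a : ι → A} (h : ∀ i ∈ s, a i ∈ p i) :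
    ∏ i ∈ s, a i ∈ ∏ i ∈ s, p i := by
  classical
  induction s using Finset.induction_on with
  | empty => exact Submodule.one_le.mp le_rfl
  | insert b s hb ih =>
    rw [Finset.prod_insert hb, Finset.prod_insert hb]
    exact Submodule.mul_mem_mul (h b (Finset.mem_insert_self b s))
      (ih fun i hi => h i (Finset.mem_insert_of_mem hi))

theorem exists_prod_smul_mem_range_pairing {d : ℕ} {ι : Type*} [Fintype ι] (j : ι → ℕ)
    (l : ι → VectorField d → ℝ) (hl : ∀ i, l i ∈ jetForms d (j i)) (x : Space d) :
    ∃ κ : NatComposition, κ.size = Fintype.card ι ∧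
      (fun f => (∏ i, l i f) • x) ∈ LinearMap.range (pairing d κ) := by
  let κ : NatComposition := ∑ i, Finsupp.single (j i) 1
  have size_eq : κ.size = Fintype.card ι := by
    have h := Finsupp.sum_finsetSum_index (s := Finset.univ)
      (g := fun i => Finsupp.single (j i) 1) (h := fun _ n => n) (fun _ => rfl) fun _ _ _ => rfl
    simpa using! h.symm
  have prod_eq : ∏ i, jetForms d (j i) = ∏ a : κ.support, jetForms d a ^ κ a := by
    have h := Finsupp.prod_finsetSum_index (s := Finset.univ)
      (g := fun i => Finsupp.single (j i) 1) (h := fun a n => jetForms d a ^ n)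
      (fun a => pow_zero _) fun a => pow_add _
    rw [Finset.prod_coe_sort κ.support fun a => jetForms d a ^ κ a]
    simpa using! h
  obtain ⟨s, hs⟩ : ∏ i, l i ∈ LinearMap.range (LinearMap.pi fun f =>
      prodEval (fun a : κ.support => κ a) fun a => factorEval f a) := by
    rw [range_pi_prodEval (fun f (a : κ.support) => factorEval f a)]
    exact prod_eq ▸ prod_mem_prod_submodule Finset.univ fun i _ => hl i
  refine ⟨κ, size_eq, x ⊗ₜ s, funext fun f => ?_⟩
  calc pairing d κ (x ⊗ₜ s) f
      = prodEval (fun a : κ.support => κ a) (fun a => factorEval f a) s • x := contract_tmul _ x s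
    _ = (∏ i, l i f) • x := by rw [← Finset.prod_apply, ← hs, LinearMap.pi_apply]

theorem IsEquivariant.diagonal_mem_iSup {d m : ℕ} {H : Subgroup (Space d ≃ₗ[ℝ] Space d)} {c : ℝˣ}
    (hc : |(c : ℝ)| ≠ 1) (hcH : LinearEquiv.smulOfUnit c ∈ H)
    {φ : ContinuousMultilinearMap ℝ (fun _ : Fin m => VectorField d) (VectorField d)}
    (hφ : IsEquivariant H φ) :
    (fun f => (φ fun _ => f) 0) ∈
      ⨆ κ : {κ : NatComposition // κ.size = m}, LinearMap.range (pairing d κ.1) := by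
  classical
  obtain ⟨I, _, j, S, p, taylor_eq⟩ := VectorField.exists_taylor_eq_sum d m
  have expand : (fun f => (φ fun _ => f) 0) = ∑ r : Fin m → I, fun f : VectorField d =>
      (∏ i, factorEval f (j (r i)) (S (r i))) • (φ fun i => p (r i)) 0 := by
    funext f
    calc (φ fun _ => f) 0 = VectorField.eval 0 (φ fun _ => f.taylor m) :=
          (hφ.apply_taylor hc hcH fun _ => f).symm
      _ = ∑ r : Fin m → I, VectorField.eval 0
            (φ fun i => factorEval f (j (r i)) (S (r i)) • p (r i)) := by
          rw [taylor_eq, φ.map_sum, map_sum]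
      _ = _ := by simp only [φ.map_smul_univ, map_smul, VectorField.eval_apply, Finset.sum_apply]
  rw [expand]
  refine Submodule.sum_mem _ fun r _ => ?_
  obtain ⟨κ, hκ, hmem⟩ := exists_prod_smul_mem_range_pairing (fun i => j (r i))
    (fun i f => factorEval f (j (r i)) (S (r i))) (fun i => ⟨S (r i), rfl⟩)
    ((φ fun i => p (r i)) 0)
  exact Submodule.mem_iSup_of_mem (p := fun κ : {κ : NatComposition // κ.size = m} =>
    LinearMap.range (pairing d κ.1)) ⟨κ, hκ.trans (Fintype.card_fin m)⟩ hmem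

/-! ### The isomorphism -/

/-- The index set of the direct sum: compositions `κ` with `|κ| = m` and `|κ'| = m - 1`, the latter
without truncated subtraction. -/
abbrev Weights (m : ℕ) : Type := {κ : NatComposition // κ.size = m ∧ κ.derived.size + 1 = m}

theorem NatComposition.support_subset_range_derived_size (κ : NatComposition) :
    κ.support ⊆ Finset.range (κ.derived.size + 1) := fun j hj => by
  have le_derived_size : j * κ j ≤ κ.derived.size :=
    κ.derived_size_eq_sum.symm ▸ Finset.single_le_sum (f := fun i : κ.support => (i : ℕ) * κ i)
      (fun _ _ => Nat.zero_le _) (Finset.mem_univ ⟨j, hj⟩)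
  have pos : 0 < κ j := Nat.pos_of_ne_zero (Finsupp.mem_support_iff.mp hj)
  exact Finset.mem_range_succ_iff.mpr ((Nat.le_mul_of_pos_right j pos).trans le_derived_size)

theorem finite_weights (m : ℕ) : Finite (Weights m) := by
  refine Finite.of_injective (β := (Finset.range m).finsuppAntidiag m) (fun κ => ⟨κ.1, ?_⟩)
    fun κ κ' h => Subtype.ext (Subtype.mk.inj h)
  have support_subset : κ.1.support ⊆ Finset.range m :=
    κ.1.support_subset_range_derived_size.trans_eq (congrArg Finset.range κ.2.2)
  refine Finset.mem_finsuppAntidiag.mpr ⟨?_, support_subset⟩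
  exact (Finsupp.sum_of_support_subset κ.1 support_subset _ fun _ _ => rfl).symm.trans κ.2.1

section

variable {d m : ℕ} (H : Subgroup (Space d ≃ₗ[ℝ] Space d))

/-- The map `φ ↦ (f ↦ φ(f, …, f)(0))`, through which both sides of the isomorphism are compared. -/
def diagonalAtOrigin (m : ℕ) : equivariantMaps H m →ₗ[ℝ] VectorField d → Space d where
  toFun φ f := (φ.1 fun _ => f) 0
  map_add' _ _ := rfl
  map_smul' _ _ := rfl

/-- The map `(S_κ)_κ ↦ (f ↦ ∑ κ, ⟨S_κ, f⟩)` on families of `H`-invariant elements. -/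
def totalPairing (m : ℕ) :
    (⨁ κ : Weights m, (symSpaceRep H κ.1).invariants) →ₗ[ℝ] VectorField d → Space d :=
  LinearMap.pi fun f => DirectSum.toModule ℝ _ (Space d) fun κ : Weights m =>
    symSpaceEval f κ.1 ∘ₗ (symSpaceRep H κ.1).invariants.subtype

theorem totalPairing_lof (κ : Weights m) (S : (symSpaceRep H κ.1).invariants) :
    totalPairing H m (DirectSum.lof ℝ _ _ κ S) = pairing d κ.1 S.1 :=
  funext fun f => DirectSum.toModule_lof ℝ (φ := fun κ : Weights m =>
    symSpaceEval f κ.1 ∘ₗ (symSpaceRep H κ.1).invariants.subtype) κ S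

theorem diagonalAtOrigin_injective : Function.Injective (diagonalAtOrigin H m) := by
  have : IsAddTorsionFree (Space d) := .of_isTorsionFree ℝ _
  refine (injective_iff_map_eq_zero _).mpr fun φ h => ?_
  have eval_eq_zero : (VectorField.eval 0).compMultilinearMap φ.1.toMultilinearMap = 0 :=
    eq_zero_of_map_const_eq_zero _ (fun σ f => congrArg (VectorField.eval 0) (φ.2.1 σ f))
      fun f => congrFun h f
  exact Subtype.ext (ContinuousMultilinearMap.ext fun f => Subtype.ext (funext fun x =>
    (φ.2.2.apply_eq f x).trans (congrArg (fun B => B fun i => (f i).translate x) eval_eq_zero)))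

theorem totalPairing_injective : Function.Injective (totalPairing (d := d) H m) := by
  classical
  refine (injective_iff_map_eq_zero _).mpr fun x hx => DFinsupp.ext fun κ => ?_
  by_contra hκ
  refine hκ (Subtype.ext (eq_zero_of_sum_symSpaceEval_eq_zero (c := fun κ : Weights m => κ.1)
    (S := fun κ => (x κ).1) Subtype.val_injective (fun f => ?_) (DFinsupp.mem_support_iff.mpr hκ)))
  calc ∑ κ ∈ DFinsupp.support x, symSpaceEval f κ.1 (x κ).1
      = ∑ κ ∈ DFinsupp.support x, totalPairing H m (DirectSum.lof ℝ _ _ κ (x κ)) f :=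
        Finset.sum_congr rfl fun κ _ => (congrFun (totalPairing_lof H κ (x κ)) f).symm
    _ = totalPairing H m x f := by
        rw [← Finset.sum_apply, ← map_sum]
        exact congrArg (fun y => totalPairing H m y f) (DirectSum.sum_support_of x)
    _ = 0 := congrFun hx f

theorem range_totalPairing_le_range_diagonalAtOrigin :
    LinearMap.range (totalPairing H m) ≤ LinearMap.range (diagonalAtOrigin H m) := by
  classical
  rintro _ ⟨x, rfl⟩
  induction x using DirectSum.induction_on with
  | zero => exact (map_zero (totalPairing H m)).symm ▸ zero_mem _
  | add x y hx hy => exact (map_add (totalPairing H m) x y).symm ▸ add_mem hx hy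
  | of κ S =>
    have local_pairing : pairing d κ.1 S.1 ∈ localDiagonals d m (Space d) :=
      (congrArg (localDiagonals d · (Space d)) κ.2.1).le
        (range_pairing_le_localDiagonals d κ.1 ⟨S.1, rfl⟩)
    obtain ⟨φ, hφ⟩ := exists_equivariantMap_of_mem_localDiagonals local_pairing fun A hA f =>
      (congrArg _ (S.2 ⟨A, hA⟩).symm).trans (symSpaceEval_affineAct ⟨A, hA⟩ f κ.1 S.1)
    exact ⟨φ, (funext hφ).trans (totalPairing_lof H κ S).symm⟩

variable {H} {c : ℝˣ} (hc : |(c : ℝ)| ≠ 1) (hcH : LinearEquiv.smulOfUnit c ∈ H)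
include hc hcH

theorem range_diagonalAtOrigin_le_range_totalPairing :
    LinearMap.range (diagonalAtOrigin H m) ≤ LinearMap.range (totalPairing H m) := by
  classical
  rintro _ ⟨φ, rfl⟩
  obtain ⟨P, hP, sum_P⟩ := (Submodule.mem_iSup_iff_exists_finsupp _ _).mp
    (φ.2.2.diagonal_mem_iSup hc hcH)
  choose S hS using hP
  have diagonal_eq : diagonalAtOrigin H m φ = ∑ κ ∈ P.support, pairing d κ.1 (S κ) :=
    sum_P.symm.trans (Finset.sum_congr rfl fun κ _ => (hS κ).symm)
  have diagonal_apply (f : VectorField d) :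
      ∑ κ ∈ P.support, symSpaceEval f κ.1 (S κ) = (φ.1 fun _ => f) 0 :=
    (Finset.sum_apply f P.support fun κ => pairing d κ.1 (S κ)).symm.trans
      (congrFun diagonal_eq f).symm
  have invariant (κ) (hκ : κ ∈ P.support) : S κ ∈ (symSpaceRep H κ.1).invariants := by
    refine mem_invariants_of_sum_symSpaceEval_affineAct Subtype.val_injective (fun A hA f => ?_) hκ
    rw [diagonal_apply, diagonal_apply, φ.2.2 A.toAffineEquiv hA]
    exact congrArg (fun x => A ((φ.1 fun _ => f) x)) (map_zero A.symm)
  rw [diagonal_eq]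
  refine Submodule.sum_mem _ fun κ hκ => ?_
  by_cases hw : κ.1.derived.size + 1 = m
  · exact ⟨DirectSum.lof ℝ _ _ (⟨κ.1, κ.2, hw⟩ : Weights m) ⟨S κ, invariant κ hκ⟩,
      totalPairing_lof H _ _⟩
  · rw [eq_zero_of_mem_invariants hc hcH (invariant κ hκ) (by rwa [κ.2]), map_zero]
    exact zero_mem _

theorem range_diagonalAtOrigin_eq_range_totalPairing :
    LinearMap.range (diagonalAtOrigin H m) = LinearMap.range (totalPairing H m) :=
  (range_diagonalAtOrigin_le_range_totalPairing hc hcH).antisymm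
    (range_totalPairing_le_range_diagonalAtOrigin H)

end

end LocalEquivariant

end

theorem mainTheorem4_general (d m : ℕ) (H : Subgroup (Space d ≃ₗ[ℝ] Space d)) {c : ℝˣ}
    (hc : |(c : ℝ)| ≠ 1) (hcH : LinearEquiv.smulOfUnit c ∈ H) :
    (∃ e : equivariantMaps H m ≃ₗ[ℝ]
        ⨁ κ : {κ : NatComposition // κ.size = m ∧ κ.derived.size + 1 = m},
          (symSpaceRep H κ.1).invariants,
      ∀ (φ : equivariantMaps H m) (f : VectorField d),
        (φ.1 fun _ => f) 0 =
          DirectSum.toModule ℝ _ (Space d)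
            (fun κ : {κ : NatComposition // κ.size = m ∧ κ.derived.size + 1 = m} =>
              symSpaceEval f κ.1 ∘ₗ (symSpaceRep H κ.1).invariants.subtype) (e φ)) ∧
    FiniteDimensional ℝ (equivariantMaps H m) := by
  let diagonal := LinearEquiv.ofInjective _ (diagonalAtOrigin_injective (m := m) H)
  let total := LinearEquiv.ofInjective _ (totalPairing_injective (m := m) H)
  let e := (diagonal.trans (LinearEquiv.ofEq _ _
    (range_diagonalAtOrigin_eq_range_totalPairing hc hcH))).trans total.symm
  have totalPairing_e (φ) : totalPairing H m (e φ) = diagonalAtOrigin H m φ :=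
    congrArg Subtype.val (total.apply_symm_apply _)
  have := finite_weights m
  exact ⟨⟨e, fun φ f => (congrFun (totalPairing_e φ) f).symm⟩, Module.Finite.equiv e.symm⟩

theorem mainTheorem4 (d m : ℕ) (H : Subgroup (Space d ≃ₗ[ℝ] Space d))
    (hH : ∀ c : ℝˣ, LinearEquiv.smulOfUnit c ∈ H) :
    (∃ e : localEquivariantMaps H m ≃ₗ[ℝ]
        ⨁ κ : {κ : NatComposition // κ.size = m ∧ κ.derived.size + 1 = m},
          (symSpaceRep H κ.1).invariants,
      ∀ (φ : localEquivariantMaps H m) (f : VectorField d),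
        (φ.1 fun _ => f) 0 =
          DirectSum.toModule ℝ _ (Space d)
            (fun κ : {κ : NatComposition // κ.size = m ∧ κ.derived.size + 1 = m} =>
              symSpaceEval f κ.1 ∘ₗ (symSpaceRep H κ.1).invariants.subtype) (e φ)) ∧
    FiniteDimensional ℝ (localEquivariantMaps H m) := by
  rw [localEquivariantMaps_eq_equivariantMaps (c := Units.mk0 2 two_ne_zero) (by norm_num) (hH _)]
  exact mainTheorem4_general d m H (c := Units.mk0 2 two_ne_zero) (by norm_num) (hH _)
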